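/- **Setting.** Let $\mathcal A=\{H_1,\dots,H_n\}$ be a finite arrangement of (pairwise distinct) affine hyperplanes in a finite-dimensional complex affine space $V$, let $\alpha_i$ be a degree-one polynomial vanishing exactly on $H_i$, let $\omega_i=d\alpha_i/\alpha_i$ (a form on $M=V\setminus\bigcup_i H_i$), and let $\lambda\in\mathbb C^n$. Let $L$ be the poset of nonempty intersections of hyperplanes, ordered by reverse inclusion (with minimum $V$), and let $r$ be the common codimension of its maximal elements. For $X\in L$ put $\mathcal A_X=\{H_i\mid X\subseteq H_i\}$, $\lambda(X)=\sum_{H_i\in\mathcal A_X}\lambda_i$ and $\omega_\lambda(X)=\sum_{H_i\in\mathcal A_X}\lambda_i\omega_i$. An element $X\in L\setminus\{V\}$ is dense if $\mathcal A_X$ is not a product of two nonempty arrangements. Let $A^\cdot$ be the graded $\mathbb C$-algebra of forms generated by $\omega_1,\dots,\omega_n$ ($A^p$ is spanned by the $p$-fold products), let $A^p(\mathcal A_X)$ be the degree-$p$ part of the subalgebra generated by the $\omega_i$ with $H_i\in\mathcal A_X$, and let $\omega_\lambda=\sum_i\lambda_i\omega_i$; then $(A^\cdot,\omega_\lambda\wedge)$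 is a complex. Let $F$ be the simplicial complex of chains in $L\setminus\{V\}$, with augmented cochain complex $C^\cdot(F,\mathbb C)$ (so $C^{-1}(F,\mathbb C)=\mathbb C$) and reduced cohomology $\tilde H^{\cdot}(F,\mathbb C)$. **The map $\phi$.** Let $\mathcal F^p$ be the sheaf on $L$ (lower ideals are open) with stalk $\mathcal F^p(X)=A^p(\mathcal A_X)$ at $X$; its restriction maps $\rho_{X,Y}$, for $Y\le X$, are the restrictions of the algebra homomorphisms with $\omega_i\mapsto\omega_i$ if $Y\subseteq H_i$ and $\omega_i\mapsto0$ otherwise. Let $d_\lambda:\mathcal F^p\to\mathcal F^{p+1}$ be left multiplication by $\omega_\lambda(X)$ at $X$. Let $\mathbb C_V\subset\mathcal F^0$ be the skyscraper sheaf $\mathbb C$ at $V$. For a sheaf $\mathcal F$ on $L$, let $C^q(L,\mathcal F)$ be the space of functions $f$ on the chains $X_0>\dots>X_q$ of $L$ with $f(X_0>\dots>X_q)\in\mathcal F(X_q)$, with differential $$(df)(X_0>\dots>X_q)=(-1)^q\rho_{X_{q-1},X_q}f(X_0>\dots>X_{q-1})+\sum_{j=0}^{q-1}(-1)^jf(X_0>\dots>\widehat{X_j}>\dots>X_q).$$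 Identify $C^{q-1}(F,\mathbb C)$ with $C^q(L,\mathbb C_V)$ via $(\gamma f)(X_0>\dots>X_q)=f(X_0>\dots>X_{q-1})$ if $X_q=V$, and $0$ otherwise; identify $A^p$ with the global sections of $\mathcal F^p$. Yuzvinsky's map $\phi:H^r(A^\cdot,\omega_\lambda\wedge)\to H^r(L,\mathbb C_V)=\tilde H^{r-1}(F,\mathbb C)$ is the composite of the connecting homomorphisms of the sequences $0\to\ker(d_\lambda|\mathcal F^p)\to\mathcal F^p\to\ker(d_\lambda|\mathcal F^{p+1})\to0$, $p=r-1,\dots,0$. Explicitly, $\phi[a]=[f]$ if and only if, for suitable representatives $a\in A^r$ and $f\in C^{r-1}(F,\mathbb C)$ of the two classes, there are $b_q\in C^q(L,\mathcal F^{r-1-q})$ for $0\le q<r$ and cochains $c_q\in C^q(L,\mathcal F^{r-q})$ for $0\le q\le r$ such that $c_0$ is the global section $a$, $d_\lambda b_q=c_q$ and $c_{q+1}=d\,b_q$ for $0\le q<r$, and $c_r=\gamma f$. **Proposition.** Assume $\lambda(X)\ne0$ for every dense $X\in L\setminus\{V\}$. Then the relation just described is the graph of a linear isomorphism $\phi:H^r(A^\cdot,\omega_\lambda\wedge)\to\tilde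 H^{r-1}(F,\mathbb C)$, and its inverse is induced by $(-1)^{r(r+1)/2}\,\upsilon$, where $\upsilon:C^{r-1}(F,\mathbb C)\to A^r$ is the linear map which sends the cochain $\xi^*$ dual to $\xi=(X_1>\dots>X_r)$ to the flag form $\omega_\lambda(X_1)\cdots\omega_\lambda(X_r)$. That is, for every cocycle $z\in C^{r-1}(F,\mathbb C)$ the element $(-1)^{r(r+1)/2}\upsilon(z)$ is a cocycle in $A^r$ and $\phi^{-1}[z]=[(-1)^{r(r+1)/2}\upsilon(z)]$. -/

import Mathlib

open scoped Topology

noncomputable section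

/-- A finite arrangement of (affine, pairwise distinct) hyperplanes `H i`, `i : ι`, in the complex
affine space `V`; `α i` is a polynomial function of degree one which vanishes exactly on `H i`. -/
structure HypArrangement (ι V : Type*) [AddCommGroup V] [Module ℂ V] where
  α : ι → V →ᵃ[ℂ] ℂ
  linear_ne_zero : ∀ i, (α i).linear ≠ 0
  distinct : ∀ i j, (∀ x, α i x = 0 ↔ α j x = 0) → i = j

namespace HypArrangement

variable {ι V : Type*} [AddCommGroup V] [Module ℂ V]

/-! ### The intersection poset -/

/-- The hyperplane `H i = {α i = 0}`. -/
def H (𝒜 : HypArrangement ι V) (i : ι) : AffineSubspace ℂ V where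
  carrier := {x | 𝒜.α i x = 0}
  smul_vsub_vadd_mem' := by
    intro c p₁ p₂ p₃ h₁ h₂ h₃
    simp only [Set.mem_ofPred_eq] at *
    rw [AffineMap.map_vadd, map_smul, AffineMap.linearMap_vsub]
    simp [h₁, h₂, h₃]

theorem mem_H {𝒜 : HypArrangement ι V} {i : ι} {x : V} : x ∈ 𝒜.H i ↔ 𝒜.α i x = 0 := Iff.rfl

/-- The intersection poset `L`: the nonempty intersections of hyperplanes (the empty intersection
is `V`), ordered by *reverse* inclusion. -/
def IntPoset (𝒜 : HypArrangement ι V) : Type _ :=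
  {X : AffineSubspace ℂ V // (X : Set V).Nonempty ∧ ∃ I : Set ι, X = ⨅ i ∈ I, 𝒜.H i}

/-- The affine subspace underlying an element of `L`. -/
def IntPoset.space {𝒜 : HypArrangement ι V} (X : 𝒜.IntPoset) : AffineSubspace ℂ V := X.1

instance (𝒜 : HypArrangement ι V) : PartialOrder 𝒜.IntPoset :=
  PartialOrder.lift (fun X => OrderDual.toDual X.space) fun _ _ h => Subtype.ext h

theorem IntPoset.le_iff {𝒜 : HypArrangement ι V} {X Y : 𝒜.IntPoset} :
    X ≤ Y ↔ Y.space ≤ X.space := Iff.rfl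

theorem IntPoset.space_injective {𝒜 : HypArrangement ι V} :
    Function.Injective (IntPoset.space : 𝒜.IntPoset → AffineSubspace ℂ V) :=
  fun _ _ h => Subtype.ext h

/-- The minimal element `V` of `L`. -/
def whole (𝒜 : HypArrangement ι V) : 𝒜.IntPoset :=
  ⟨⊤, ⟨0, AffineSubspace.mem_top ℂ V 0⟩, ∅, by simp⟩

theorem whole_le {𝒜 : HypArrangement ι V} (X : 𝒜.IntPoset) : 𝒜.whole ≤ X :=
  IntPoset.le_iff.2 (show X.space ≤ ⊤ from le_top)

instance [Finite ι] (𝒜 : HypArrangement ι V) : Finite 𝒜.IntPoset := by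
  have h : ∀ X : 𝒜.IntPoset, ∃ I : Set ι, X.space = ⨅ i ∈ I, 𝒜.H i := fun X => X.2.2
  choose f hf using h
  refine Finite.of_injective f fun X Y hXY => IntPoset.space_injective ?_
  rw [hf X, hf Y, hXY]

/-- The codimension of `X ∈ L`. -/
def IntPoset.codim {𝒜 : HypArrangement ι V} (X : 𝒜.IntPoset) : ℕ :=
  Module.finrank ℂ V - Module.finrank ℂ X.space.direction

/-- The rank `r` of the arrangement: the largest codimension of an element of `L`, which is the
common codimension of the maximal elements of `L`. -/
def rank (𝒜 : HypArrangement ι V) : ℕ := ⨆ X : 𝒜.IntPoset, X.codim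

open Classical in
/-- `𝒜_X = {i | X ⊆ H i}`. -/
def loc [Fintype ι] (𝒜 : HypArrangement ι V) (X : 𝒜.IntPoset) : Finset ι :=
  Finset.univ.filter fun i => X.space ≤ 𝒜.H i

theorem mem_loc [Fintype ι] {𝒜 : HypArrangement ι V} {X : 𝒜.IntPoset} {i : ι} :
    i ∈ 𝒜.loc X ↔ X.space ≤ 𝒜.H i := by simp [loc]

theorem space_eq_iInf_loc [Fintype ι] {𝒜 : HypArrangement ι V} (X : 𝒜.IntPoset) :
    X.space = ⨅ i ∈ 𝒜.loc X, 𝒜.H i := by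
  obtain ⟨I, hI⟩ := X.2.2
  change X.space = _ at hI
  refine le_antisymm (le_iInf₂ fun i hi => mem_loc.1 hi) ?_
  conv_rhs => rw [hI]
  exact le_iInf₂ fun i hi => iInf₂_le i (mem_loc.2 (by rw [hI]; exact iInf₂_le i hi))

/-- The subarrangement `{H i | i ∈ S}` is decomposable: for some splitting `V = V₁ ⊕ V₂` it is a
product of two nonempty arrangements, the hyperplanes of the first (`S₁`) being of the form
`H' × V₂`, and those of the second (`S₂`) of the form `V₁ × H'`. -/
def Decomposable (𝒜 : HypArrangement ι V) (S : Set ι) : Prop :=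
  ∃ V₁ V₂ : Submodule ℂ V, IsCompl V₁ V₂ ∧ ∃ S₁ S₂ : Set ι, S₁.Nonempty ∧ S₂.Nonempty ∧
    S = S₁ ∪ S₂ ∧ (∀ i ∈ S₁, V₂ ≤ (𝒜.H i).direction) ∧ (∀ i ∈ S₂, V₁ ≤ (𝒜.H i).direction)

/-- `X ∈ L - {V}` is dense if `𝒜_X` is not decomposable. -/
def IsDense [Fintype ι] (𝒜 : HypArrangement ι V) (X : 𝒜.IntPoset) : Prop :=
  X ≠ 𝒜.whole ∧ ¬ 𝒜.Decomposable (𝒜.loc X : Set ι)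

/-! ### Logarithmic forms and the Orlik-Solomon algebra -/

/-- The complement `M` of the arrangement. -/
def Compl (𝒜 : HypArrangement ι V) : Type _ := {x : V // ∀ i, 𝒜.α i x ≠ 0}

/-- Differential forms (of mixed degree) on the open set `M ⊆ V`: functions on `M` with values in
the exterior algebra of `V*`, with the pointwise exterior product. -/
abbrev Form (𝒜 : HypArrangement ι V) : Type _ := 𝒜.Compl → ExteriorAlgebra ℂ (Module.Dual ℂ V)

/-- The logarithmic form `ω_i = dα_i / α_i` as a form on `M`. -/
def dlog (𝒜 : HypArrangement ι V) (i : ι) : 𝒜.Form :=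
  fun x => (𝒜.α i x.1)⁻¹ • ExteriorAlgebra.ι ℂ (𝒜.α i).linear

/-- The subalgebra of forms generated by the `ω_i`. -/
def osSubalgebra (𝒜 : HypArrangement ι V) : Subalgebra ℂ 𝒜.Form :=
  Algebra.adjoin ℂ (Set.range 𝒜.dlog)

/-- The Orlik-Solomon algebra `A`: the `ℂ`-algebra of forms generated by the `ω_i`. -/
def OS (𝒜 : HypArrangement ι V) : Type _ := 𝒜.osSubalgebra

instance (𝒜 : HypArrangement ι V) : Ring 𝒜.OS := inferInstanceAs (Ring 𝒜.osSubalgebra)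

instance (𝒜 : HypArrangement ι V) : Algebra ℂ 𝒜.OS := inferInstanceAs (Algebra ℂ 𝒜.osSubalgebra)

/-- The inclusion of `A` into the algebra of forms. -/
def toForm (𝒜 : HypArrangement ι V) : 𝒜.OS →ₐ[ℂ] 𝒜.Form := 𝒜.osSubalgebra.val

theorem toForm_injective (𝒜 : HypArrangement ι V) : Function.Injective 𝒜.toForm :=
  Subtype.val_injective

/-- `ω_i` as an element of `A`. -/
def ω (𝒜 : HypArrangement ι V) (i : ι) : 𝒜.OS :=
  (⟨𝒜.dlog i, Algebra.subset_adjoin ⟨i, rfl⟩⟩ : 𝒜.osSubalgebra)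

theorem toForm_ω (𝒜 : HypArrangement ι V) (i : ι) : 𝒜.toForm (𝒜.ω i) = 𝒜.dlog i := rfl

/-- The degree `p` part `A^p` of `A`: the span of the `p`-fold products of the `ω_i`. -/
def grade (𝒜 : HypArrangement ι V) (p : ℕ) : Submodule ℂ 𝒜.OS :=
  Submodule.span ℂ (Set.range 𝒜.ω) ^ p

/-- The stalk `F^p(X) = A^p(𝒜_X)`, as a subspace of `A` (forms on the complement of `𝒜_X`
are identified with their restrictions to `M`). -/
def stalk [Fintype ι] (𝒜 : HypArrangement ι V) (p : ℕ) (X : 𝒜.IntPoset) : Submodule ℂ 𝒜.OS :=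
  Submodule.span ℂ (𝒜.ω '' (𝒜.loc X : Set ι)) ^ p

/-! ### The restriction maps

`restr Y` is the algebra homomorphism `A → A(𝒜_Y)` sending `ω_i` to itself if `Y ⊆ H i` and to `0`
otherwise. It exists because it is the limit, as `t → 0`, of pulling back along the homothety
`x ↦ y + t (x - y)` centred at a generic point `y` of `Y`. -/

/-- Finite sums of scalar functions continuous at `0` times constant vectors. -/
def contSpan (E : Type*) [AddCommGroup E] [Module ℂ E] : Submodule ℂ (ℂ → E) :=
  Submodule.span ℂ {F | ∃ (k : ℂ → ℂ) (w : E), ContinuousAt k 0 ∧ F = fun t => k t • w}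

theorem contSpan_mul {E : Type*} [Ring E] [Algebra ℂ E] {F G : ℂ → E}
    (hF : F ∈ contSpan E) (hG : G ∈ contSpan E) : F * G ∈ contSpan E := by
  have h : F * G ∈ contSpan E * contSpan E := Submodule.mul_mem_mul hF hG
  refine (show contSpan E * contSpan E ≤ contSpan E from ?_) h
  unfold contSpan
  rw [Submodule.span_mul_span, Submodule.span_le]
  rintro _ ⟨_, ⟨k, w, hk, rfl⟩, _, ⟨l, v, hl, rfl⟩, rfl⟩
  refine Submodule.subset_span ⟨fun t => k t * l t, w * v, hk.mul hl, ?_⟩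
  funext t
  simp [smul_smul, mul_comm]

theorem contSpan_zero {E : Type*} [AddCommGroup E] [Module ℂ E] {F : ℂ → E}
    (hF : F ∈ contSpan E) (h0 : ∀ᶠ t in 𝓝[≠] (0 : ℂ), F t = 0) : F 0 = 0 := by
  rw [← Module.forall_dual_apply_eq_zero_iff ℂ]
  intro ψ
  have hc : ∀ G ∈ contSpan E, ContinuousAt (fun t => ψ (G t)) 0 := by
    intro G hG
    induction hG using Submodule.span_induction with
    | zero => simpa using continuousAt_const
    | add x y _ _ hx hy => simpa using! hx.add hy
    | smul c x _ hx => simpa using hx.const_mul c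
    | mem x hx =>
      obtain ⟨k, w, hk, rfl⟩ := hx
      simpa using! hk.mul (continuousAt_const (y := ψ w))
  have h1 : Filter.Tendsto (fun t => ψ (F t)) (𝓝[≠] (0 : ℂ)) (𝓝 (ψ (F 0))) :=
    (hc F hF).tendsto.mono_left nhdsWithin_le_nhds
  have h2 : Filter.Tendsto (fun t => ψ (F t)) (𝓝[≠] (0 : ℂ)) (𝓝 0) :=
    tendsto_const_nhds.congr' (h0.mono fun t ht => by simp [ht])
  exact tendsto_nhds_unique h1 h2

theorem α_lineMap (𝒜 : HypArrangement ι V) (i : ι) (y x : V) (t : ℂ) :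
    𝒜.α i (AffineMap.lineMap y x t) = (1 - t) * 𝒜.α i y + t * 𝒜.α i x := by
  rw [AffineMap.apply_lineMap, AffineMap.lineMap_apply]
  simp only [vsub_eq_sub, vadd_eq_add, smul_eq_mul]
  ring

theorem eventually_lineMap (𝒜 : HypArrangement ι V) (i : ι) (y x : V)
    (h : 𝒜.α i y ≠ 0 ∨ 𝒜.α i x ≠ 0) :
    ∀ᶠ t in 𝓝[≠] (0 : ℂ), 𝒜.α i (AffineMap.lineMap y x t) ≠ 0 := by
  simp only [α_lineMap]
  by_cases hy : 𝒜.α i y = 0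
  · have hx : 𝒜.α i x ≠ 0 := by tauto
    filter_upwards [self_mem_nhdsWithin] with t ht
    simpa [hy] using ⟨ht, hx⟩
  · refine nhdsWithin_le_nhds (ContinuousAt.eventually_ne (by fun_prop) (by simpa using hy))

/-- A generic point of `Y`. -/
theorem exists_generic [Fintype ι] (𝒜 : HypArrangement ι V) (Y : 𝒜.IntPoset) :
    ∃ y ∈ Y.space, ∀ i, 𝒜.α i y = 0 ↔ i ∈ 𝒜.loc Y := by
  classical
  obtain ⟨y₀, hy₀⟩ := Y.2.1
  have key : ∀ s : Finset ι, ∃ y ∈ Y.space, ∀ i ∈ s, i ∉ 𝒜.loc Y → 𝒜.α i y ≠ 0 := by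
    intro s
    induction s using Finset.induction_on with
    | empty => exact ⟨y₀, hy₀, by simp⟩
    | insert i s _ ih =>
      obtain ⟨y, hy, hs⟩ := ih
      by_cases hi : i ∈ 𝒜.loc Y
      · refine ⟨y, hy, fun j hj hj' => ?_⟩
        rcases Finset.mem_insert.1 hj with rfl | hj
        · exact absurd hi hj'
        · exact hs j hj hj'
      · have hx : ∃ x ∈ Y.space, 𝒜.α i x ≠ 0 := by
          by_contra! hcon
          exact hi (mem_loc.2 fun x hx => hcon x hx)
        obtain ⟨x, hx, hxi⟩ := hx
        have h1 : ∀ᶠ t in 𝓝[≠] (0 : ℂ), ∀ j ∈ insert i s, j ∉ 𝒜.loc Y →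
            𝒜.α j (AffineMap.lineMap y x t) ≠ 0 := by
          rw [Finset.eventually_all]
          intro j hj
          by_cases hj' : j ∈ 𝒜.loc Y
          · simp [hj']
          · refine (𝒜.eventually_lineMap j y x ?_).mono fun t ht _ => ht
            rcases Finset.mem_insert.1 hj with rfl | hj
            · exact Or.inr hxi
            · exact Or.inl (hs j hj hj')
        obtain ⟨t, ht⟩ := h1.exists
        exact ⟨_, AffineMap.lineMap_mem t hy hx, ht⟩
  obtain ⟨y, hy, h⟩ := key Finset.univ
  refine ⟨y, hy, fun i => ⟨fun hi => ?_, fun hi => mem_loc.1 hi hy⟩⟩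
  by_contra hi'
  exact h i (Finset.mem_univ i) hi' hi

theorem dlog_eval (𝒜 : HypArrangement ι V) (a : FreeAlgebra ℂ ι) (x : 𝒜.Compl) :
    𝒜.toForm (FreeAlgebra.lift ℂ 𝒜.ω a) x =
      FreeAlgebra.lift ℂ (fun i => 𝒜.dlog i x) a := by
  have : ((Pi.evalAlgHom ℂ _ x).comp 𝒜.toForm).comp (FreeAlgebra.lift ℂ 𝒜.ω) =
      FreeAlgebra.lift ℂ (fun i => 𝒜.dlog i x) := by
    ext i
    simp [toForm_ω]
  exact DFunLike.congr_fun this a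

open Classical in
/-- The images of the generators under the restriction map. -/
def restrGen [Fintype ι] (𝒜 : HypArrangement ι V) (Y : 𝒜.IntPoset) (i : ι) : 𝒜.OS :=
  if i ∈ 𝒜.loc Y then 𝒜.ω i else 0

theorem restrGen_eq_zero [Fintype ι] (𝒜 : HypArrangement ι V) (Y : 𝒜.IntPoset)
    (a : FreeAlgebra ℂ ι) (ha : FreeAlgebra.lift ℂ 𝒜.ω a = 0) :
    FreeAlgebra.lift ℂ (𝒜.restrGen Y) a = 0 := by
  classical
  obtain ⟨y, hy, hgen⟩ := 𝒜.exists_generic Y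
  refine 𝒜.toForm_injective (funext fun x => ?_)
  let c : ι → ℂ → ℂ := fun i t =>
    if i ∈ 𝒜.loc Y then (𝒜.α i x.1)⁻¹ else t * ((1 - t) * 𝒜.α i y + t * 𝒜.α i x.1)⁻¹
  let Φ : FreeAlgebra ℂ ι →ₐ[ℂ] (ℂ → ExteriorAlgebra ℂ (Module.Dual ℂ V)) :=
    FreeAlgebra.lift ℂ fun i t => c i t • ExteriorAlgebra.ι ℂ (𝒜.α i).linear
  have hΦ : ∀ (t : ℂ) b, Φ b t =
      FreeAlgebra.lift ℂ (fun i => c i t • ExteriorAlgebra.ι ℂ (𝒜.α i).linear) b := by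
    intro t b
    have : (Pi.evalAlgHom ℂ (fun _ : ℂ => ExteriorAlgebra ℂ (Module.Dual ℂ V)) t).comp Φ =
        FreeAlgebra.lift ℂ (fun i => c i t • ExteriorAlgebra.ι ℂ (𝒜.α i).linear) := by
      ext i
      simp [Φ]
    exact DFunLike.congr_fun this b
  have hcont : ∀ b, Φ b ∈ contSpan (ExteriorAlgebra ℂ (Module.Dual ℂ V)) := by
    intro b
    induction b using FreeAlgebra.induction with
    | grade0 r =>
      refine Submodule.subset_span ⟨fun _ => r, 1, continuousAt_const, ?_⟩
      rw [AlgHom.commutes]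
      funext t
      simp [Algebra.algebraMap_eq_smul_one]
    | grade1 i =>
      refine Submodule.subset_span ⟨c i, ExteriorAlgebra.ι ℂ (𝒜.α i).linear, ?_, ?_⟩
      · by_cases hi : i ∈ 𝒜.loc Y
        · simpa [c, hi] using continuousAt_const
        · have hiy : 𝒜.α i y ≠ 0 := fun h => hi ((hgen i).1 h)
          simp only [c, hi, if_false]
          refine continuousAt_id.mul (ContinuousAt.inv₀ (by fun_prop) (by simpa using hiy))
      · simp [Φ]
    | mul a b ha hb => rw [map_mul]; exact contSpan_mul ha hb
    | add a b ha hb => rw [map_add]; exact add_mem ha hb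
  have hzero : ∀ᶠ t in 𝓝[≠] (0 : ℂ), Φ a t = 0 := by
    have h1 : ∀ᶠ t in 𝓝[≠] (0 : ℂ), ∀ i, 𝒜.α i (AffineMap.lineMap y x.1 t) ≠ 0 :=
      Filter.eventually_all.2 fun i => 𝒜.eventually_lineMap i y x.1 (Or.inr (x.2 i))
    filter_upwards [h1, self_mem_nhdsWithin] with t ht ht0
    have ht0' : t ≠ 0 := ht0
    have h2 := 𝒜.dlog_eval a ⟨_, ht⟩
    rw [ha] at h2
    have h3 : (ExteriorAlgebra.map (t • (LinearMap.id : Module.Dual ℂ V →ₗ[ℂ] _))).comp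
        (FreeAlgebra.lift ℂ (fun i => 𝒜.dlog i ⟨_, ht⟩)) =
        FreeAlgebra.lift ℂ (fun i => c i t • ExteriorAlgebra.ι ℂ (𝒜.α i).linear) := by
      ext i
      by_cases hi : i ∈ 𝒜.loc Y
      · have hiy : 𝒜.α i y = 0 := (hgen i).2 hi
        simp only [AlgHom.comp_apply, Function.comp_apply, FreeAlgebra.lift_ι_apply, dlog, α_lineMap]
        simp [c, hi, hiy, smul_smul, ht0']
      · simp only [AlgHom.comp_apply, Function.comp_apply, FreeAlgebra.lift_ι_apply, dlog, α_lineMap]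
        simp [c, hi, smul_smul, mul_comm]
    rw [hΦ, ← h3, AlgHom.comp_apply, ← h2]
    exact map_zero _
  have hfin := contSpan_zero (hcont a) hzero
  rw [hΦ] at hfin
  have h4 : ((Pi.evalAlgHom ℂ _ x).comp 𝒜.toForm).comp (FreeAlgebra.lift ℂ (𝒜.restrGen Y)) =
      FreeAlgebra.lift ℂ (fun i => c i 0 • ExteriorAlgebra.ι ℂ (𝒜.α i).linear) := by
    ext i
    by_cases hi : i ∈ 𝒜.loc Y
    · simp [restrGen, c, hi, toForm_ω, dlog]
    · simp [restrGen, c, hi]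
  exact (DFunLike.congr_fun h4 a).trans hfin

theorem restrGen_congr [Fintype ι] (𝒜 : HypArrangement ι V) (Y : 𝒜.IntPoset)
    {a b : FreeAlgebra ℂ ι} (h : FreeAlgebra.lift ℂ 𝒜.ω a = FreeAlgebra.lift ℂ 𝒜.ω b) :
    FreeAlgebra.lift ℂ (𝒜.restrGen Y) a = FreeAlgebra.lift ℂ (𝒜.restrGen Y) b := by
  rw [← sub_eq_zero, ← map_sub]
  exact 𝒜.restrGen_eq_zero Y _ (by rw [map_sub, h, sub_self])

theorem lift_ω_surjective (𝒜 : HypArrangement ι V) :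
    Function.Surjective (FreeAlgebra.lift ℂ 𝒜.ω) := by
  intro a
  have ha : 𝒜.toForm a ∈ 𝒜.osSubalgebra := Subtype.property (p := (· ∈ 𝒜.osSubalgebra)) a
  have h : (𝒜.toForm.comp (FreeAlgebra.lift ℂ 𝒜.ω)).range = 𝒜.osSubalgebra := by
    have : 𝒜.toForm.comp (FreeAlgebra.lift ℂ 𝒜.ω) = FreeAlgebra.lift ℂ 𝒜.dlog := by
      ext i
      simp [toForm_ω]
    rw [this, osSubalgebra, Algebra.adjoin_range_eq_range_freeAlgebra_lift]
  rw [← h] at ha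
  obtain ⟨b, hb⟩ := ha
  exact ⟨b, 𝒜.toForm_injective hb⟩

/-- The restriction map of the sheaves `F^p` to the stalk at `Y`, as a map on all of `A`: the
algebra homomorphism with `ω_i ↦ ω_i` if `Y ⊆ H i` and `ω_i ↦ 0` otherwise. On `F^p(X)`, `Y ≤ X`,
it is the projection `ρ_{X, Y}` onto the direct summand `F^p(Y)`; on `A^p` it is the passage from a
global section of `F^p` to its germ at `Y`. See `restr_of_le` and `restr_of_not_le`. -/
def restr [Fintype ι] (𝒜 : HypArrangement ι V) (Y : 𝒜.IntPoset) : 𝒜.OS →ₐ[ℂ] 𝒜.OS :=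
  AlgHom.ofLinearMap
    { toFun := fun a => FreeAlgebra.lift ℂ (𝒜.restrGen Y)
        (Function.surjInv 𝒜.lift_ω_surjective a)
      map_add' := fun a b => by
        rw [← map_add]
        apply 𝒜.restrGen_congr
        simp [Function.surjInv_eq]
      map_smul' := fun c a => by
        rw [← map_smul]
        apply 𝒜.restrGen_congr
        simp [Function.surjInv_eq] }
    (by
      rw [← map_one (FreeAlgebra.lift ℂ (𝒜.restrGen Y))]
      apply 𝒜.restrGen_congr
      simp [Function.surjInv_eq])
    (fun a b => by
      change _ = FreeAlgebra.lift ℂ (𝒜.restrGen Y) _ * FreeAlgebra.lift ℂ (𝒜.restrGen Y) _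
      rw [← map_mul]
      apply 𝒜.restrGen_congr
      simp [Function.surjInv_eq])

open Classical in
theorem restr_ω [Fintype ι] (𝒜 : HypArrangement ι V) (Y : 𝒜.IntPoset) (i : ι) :
    𝒜.restr Y (𝒜.ω i) = if i ∈ 𝒜.loc Y then 𝒜.ω i else 0 := by
  have h : 𝒜.restr Y (𝒜.ω i) = FreeAlgebra.lift ℂ (𝒜.restrGen Y) (FreeAlgebra.ι ℂ i) :=
    𝒜.restrGen_congr Y (by simp [Function.surjInv_eq])
  rw [h, FreeAlgebra.lift_ι_apply, restrGen]

/-- `restr Y` is the identity on the direct summands `A_Z = A^p(𝒜_Z)` with `Z ≤ Y`. -/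
theorem restr_of_le [Fintype ι] (𝒜 : HypArrangement ι V) {Y Z : 𝒜.IntPoset} (h : Z ≤ Y) {p : ℕ}
    {a : 𝒜.OS} (ha : a ∈ 𝒜.stalk p Z) : 𝒜.restr Y a = a := by
  rw [stalk, Submodule.span_pow] at ha
  induction ha using Submodule.span_induction with
  | zero => simp
  | add x y _ _ hx hy => rw [map_add, hx, hy]
  | smul c x _ hx => rw [map_smul, hx]
  | mem x hx =>
    obtain ⟨f, rfl⟩ := Set.mem_pow.1 hx
    rw [map_list_prod, List.map_ofFn]
    congr 2
    funext j
    obtain ⟨i, hi, hij⟩ := (f j).2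
    have hi' : i ∈ 𝒜.loc Y := mem_loc.2 ((IntPoset.le_iff.1 h).trans (mem_loc.1 hi))
    simp [← hij, restr_ω, hi']

/-- `restr Y` is zero on the direct summands `A_Z = A^p(𝒜_Z)`, `p = codim Z`, with `Z ≰ Y`. -/
theorem restr_of_not_le [Fintype ι] [FiniteDimensional ℂ V] (𝒜 : HypArrangement ι V)
    {Y Z : 𝒜.IntPoset} (h : ¬ Z ≤ Y) {a : 𝒜.OS} (ha : a ∈ 𝒜.stalk Z.codim Z) :
    𝒜.restr Y a = 0 := by
  rw [stalk, Submodule.span_pow] at ha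
  induction ha using Submodule.span_induction with
  | zero => simp
  | add x y _ _ hx hy => rw [map_add, hx, hy, add_zero]
  | smul c x _ hx => rw [map_smul, hx, smul_zero]
  | mem x hx =>
    obtain ⟨f, rfl⟩ := Set.mem_pow.1 hx
    choose w hw hwf using fun j => (f j).2
    by_cases hY : ∀ j, w j ∈ 𝒜.loc Y
    · have hli : ¬ LinearIndependent ℂ fun j => (𝒜.α (w j)).linear := by
        intro hli
        refine h (IntPoset.le_iff.2 ?_)
        let W : Submodule ℂ (Module.Dual ℂ V) :=
          Submodule.span ℂ (Set.range fun j => (𝒜.α (w j)).linear)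
        have hW : Module.finrank ℂ W = Z.codim := by
          simpa using finrank_span_eq_card hli
        have hW2 := Subspace.finrank_add_finrank_dualCoannihilator_eq W
        have hle : Z.space.direction ≤ W.dualCoannihilator := by
          intro v hv
          rw [Submodule.mem_dualCoannihilator]
          obtain ⟨z, hz⟩ := Z.2.1
          intro φ hφ
          induction hφ using Submodule.span_induction with
          | zero => simp
          | add x y _ _ hx hy => simp [hx, hy]
          | smul c x _ hx => simp [hx]
          | mem x hx =>
            obtain ⟨j, rfl⟩ := hx
            have h1 : 𝒜.α (w j) (v +ᵥ z) = 0 :=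
              mem_loc.1 (hw j) (AffineSubspace.vadd_mem_of_mem_direction hv hz)
            have h2 : 𝒜.α (w j) z = 0 := mem_loc.1 (hw j) hz
            rw [AffineMap.map_vadd, h2] at h1
            simpa using h1
        have heq : Z.space.direction = W.dualCoannihilator := by
          refine Submodule.eq_of_le_of_finrank_eq hle ?_
          have h3 := Submodule.finrank_le Z.space.direction
          have h4 : Z.codim = Module.finrank ℂ V - Module.finrank ℂ Z.space.direction := rfl
          omega
        intro y hy
        obtain ⟨z, hz⟩ := Z.2.1
        have hyz : y -ᵥ z ∈ Z.space.direction := by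
          rw [heq, Submodule.mem_dualCoannihilator]
          intro φ hφ
          induction hφ using Submodule.span_induction with
          | zero => simp
          | add x y _ _ hx hy => rw [LinearMap.add_apply, hx, hy, add_zero]
          | smul c x _ hx => rw [LinearMap.smul_apply, hx, smul_zero]
          | mem x hx =>
            obtain ⟨j, rfl⟩ := hx
            have h1 : 𝒜.α (w j) y = 0 := mem_loc.1 (hY j) hy
            have h2 : 𝒜.α (w j) z = 0 := mem_loc.1 (hw j) hz
            rw [AffineMap.linearMap_vsub, h1, h2, vsub_self]
        simpa using AffineSubspace.vadd_mem_of_mem_direction hyz hz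
      have h0 : (List.ofFn fun j => (f j : 𝒜.OS)).prod = 0 := by
        refine 𝒜.toForm_injective (funext fun x => ?_)
        have h1 := map_list_prod ((Pi.evalAlgHom ℂ _ x).comp 𝒜.toForm)
          (List.ofFn fun j => (f j : 𝒜.OS))
        refine h1.trans ?_
        rw [List.map_ofFn]
        have h2 : (⇑((Pi.evalAlgHom ℂ _ x).comp 𝒜.toForm) ∘ fun j => (f j : 𝒜.OS)) =
            fun j => ExteriorAlgebra.ι ℂ ((𝒜.α (w j) x.1)⁻¹ • (𝒜.α (w j)).linear) := by
          funext j
          simp [← hwf, toForm_ω, dlog]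
        rw [h2, ← ExteriorAlgebra.ιMulti_apply, AlternatingMap.map_smul_univ,
          AlternatingMap.map_linearDependent _ _ hli, smul_zero]
        rfl
      rw [h0, map_zero]
    · push Not at hY
      obtain ⟨j, hj⟩ := hY
      rw [map_list_prod, List.map_ofFn]
      refine List.prod_eq_zero ?_
      rw [List.mem_ofFn]
      exact ⟨j, by simp [← hwf, restr_ω, hj]⟩

/-! ### The complex `(A, ω_λ ∧)` -/

/-- `ω_λ = ∑ λ_i ω_i`. -/
def ωTotal [Fintype ι] (𝒜 : HypArrangement ι V) (lam : ι → ℂ) : 𝒜.OS := ∑ i, lam i • 𝒜.ω i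

/-- `ω_λ(X) = ∑_{X ⊆ H_i} λ_i ω_i`. -/
def ωAt [Fintype ι] (𝒜 : HypArrangement ι V) (lam : ι → ℂ) (X : 𝒜.IntPoset) : 𝒜.OS :=
  ∑ i ∈ 𝒜.loc X, lam i • 𝒜.ω i

/-- The cocycles of `(A, ω_λ ∧)` in degree `p`. -/
def osCocycles [Fintype ι] (𝒜 : HypArrangement ι V) (lam : ι → ℂ) (p : ℕ) : Submodule ℂ 𝒜.OS :=
  𝒜.grade p ⊓ LinearMap.ker (LinearMap.mulLeft ℂ (𝒜.ωTotal lam))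

/-- The coboundaries of `(A, ω_λ ∧)` in degree `p` (where `A^{-1} = 0`). -/
def osCoboundaries [Fintype ι] (𝒜 : HypArrangement ι V) (lam : ι → ℂ) : ℕ → Submodule ℂ 𝒜.OS
  | 0 => ⊥
  | p + 1 => (𝒜.grade p).map (LinearMap.mulLeft ℂ (𝒜.ωTotal lam))

/-- The cohomology `H^p(A, ω_λ ∧)`. -/
abbrev OSCohomology [Fintype ι] (𝒜 : HypArrangement ι V) (lam : ι → ℂ) (p : ℕ) : Type _ :=
  𝒜.osCocycles lam p ⧸ (𝒜.osCoboundaries lam p).submoduleOf (𝒜.osCocycles lam p)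

/-! ### Chains of the intersection poset and the Folkman complex -/

/-- The chains `(s 0 > s 1 > ⋯ > s (n - 1))` of `n` elements of `L`. -/
def Chain (𝒜 : HypArrangement ι V) (n : ℕ) : Type _ := {s : Fin n → 𝒜.IntPoset // StrictAnti s}

/-- Omit the `j`-th element of a chain. -/
def Chain.erase {𝒜 : HypArrangement ι V} {n : ℕ} (s : 𝒜.Chain (n + 1)) (j : Fin (n + 1)) :
    𝒜.Chain n :=
  ⟨s.1 ∘ j.succAbove, s.2.comp_strictMono (Fin.strictMono_succAbove j)⟩

/-- The last (smallest) element of a nonempty chain. -/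
def Chain.last {𝒜 : HypArrangement ι V} {n : ℕ} (s : 𝒜.Chain (n + 1)) : 𝒜.IntPoset :=
  s.1 (Fin.last n)

/-- The simplices of the Folkman complex `F` with `n` vertices: the chains of `n` elements of
`L - {V}`. For `n = 0` this is the empty simplex. -/
def Simplex (𝒜 : HypArrangement ι V) (n : ℕ) : Type _ :=
  {s : 𝒜.Chain n // ∀ j, s.1 j ≠ 𝒜.whole}

instance [Finite ι] (𝒜 : HypArrangement ι V) (n : ℕ) : Finite (𝒜.Simplex n) :=
  Finite.of_injective (fun s : 𝒜.Simplex n => s.1.1) fun _ _ h => Subtype.ext (Subtype.ext h)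

instance [Finite ι] (𝒜 : HypArrangement ι V) (n : ℕ) : Fintype (𝒜.Simplex n) :=
  Fintype.ofFinite _

/-- The face opposite to the `j`-th vertex. -/
def Simplex.face {𝒜 : HypArrangement ι V} {n : ℕ} (s : 𝒜.Simplex (n + 1)) (j : Fin (n + 1)) :
    𝒜.Simplex n :=
  ⟨s.1.erase j, fun k => s.2 (j.succAbove k)⟩

/-- The cochains `C^{p-1}(F, ℂ)` of the augmented simplicial cochain complex of `F`, indexed by
the number `p` of vertices; in particular `FCochain 0` is `C^{-1}(F, ℂ) = ℂ`. -/
abbrev FCochain (𝒜 : HypArrangement ι V) (p : ℕ) : Type _ := 𝒜.Simplex p → ℂ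

/-- The coboundary map `C^{p-1}(F, ℂ) → C^p(F, ℂ)`. -/
def fCoboundary (𝒜 : HypArrangement ι V) (p : ℕ) : 𝒜.FCochain p →ₗ[ℂ] 𝒜.FCochain (p + 1) where
  toFun f s := ∑ j : Fin (p + 1), (-1 : ℂ) ^ (j : ℕ) * f (s.face j)
  map_add' f g := by
    funext s
    simp [mul_add, Finset.sum_add_distrib]
  map_smul' c f := by
    funext s
    simp [Finset.mul_sum, mul_left_comm]

/-- The coboundaries in `C^{p-1}(F, ℂ)` (where `C^{-2} = 0`). -/
def fCoboundaries (𝒜 : HypArrangement ι V) : (p : ℕ) → Submodule ℂ (𝒜.FCochain p)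
  | 0 => ⊥
  | p + 1 => LinearMap.range (𝒜.fCoboundary p)

/-- The reduced cohomology `H̃^{p-1}(F, ℂ)` of the Folkman complex. -/
abbrev FCohomology (𝒜 : HypArrangement ι V) (p : ℕ) : Type _ :=
  LinearMap.ker (𝒜.fCoboundary p) ⧸
    (𝒜.fCoboundaries p).submoduleOf (LinearMap.ker (𝒜.fCoboundary p))

/-! ### The cochain complexes `C(L, F^p)` and Yuzvinsky's isomorphism -/

/-- `C^q(L, F^p)`: the functions on the chains `(X_0 > ⋯ > X_q)` of `L` whose value at such a chain
lies in `F^p(X_q)`. -/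
def sheafCochains [Fintype ι] (𝒜 : HypArrangement ι V) (p q : ℕ) :
    Submodule ℂ (𝒜.Chain (q + 1) → 𝒜.OS) :=
  Submodule.pi Set.univ fun s => 𝒜.stalk p s.last

/-- The differential `d` from `q`-cochains to `(q+1)`-cochains:
`(d b)(X_0 > ⋯ > X_{q+1}) = ∑_{j ≤ q} (-1)^j b(⋯ > X̂_j > ⋯) + (-1)^{q+1} ρ b(X_0 > ⋯ > X_q)`,
where `ρ` is the restriction from `X_q` to `X_{q+1}`. -/
def sheafD [Fintype ι] (𝒜 : HypArrangement ι V) (q : ℕ) (b : 𝒜.Chain (q + 1) → 𝒜.OS) :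
    𝒜.Chain (q + 2) → 𝒜.OS := fun s =>
  (∑ j : Fin (q + 1), (-1 : ℂ) ^ (j : ℕ) • b (s.erase j.castSucc)) +
    (-1 : ℂ) ^ (q + 1) • 𝒜.restr s.last (b (s.erase (Fin.last (q + 1))))

/-- The map `d_λ` on cochains induced by the sheaf homomorphism `d_λ : F^p → F^{p+1}`, which is left
multiplication by `ω_λ(X)` on the stalks at `X`. -/
def dLam [Fintype ι] (𝒜 : HypArrangement ι V) (lam : ι → ℂ) {q : ℕ}
    (b : 𝒜.Chain (q + 1) → 𝒜.OS) : 𝒜.Chain (q + 1) → 𝒜.OS :=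
  fun s => 𝒜.ωAt lam s.last * b s

/-- The `0`-cochain in `C^0(L, F^p)` of the global section of `F^p` given by `a ∈ A^p`. -/
def globalSection [Fintype ι] (𝒜 : HypArrangement ι V) (a : 𝒜.OS) : 𝒜.Chain 1 → 𝒜.OS :=
  fun s => 𝒜.restr s.last a

theorem erase_last_ne_whole {𝒜 : HypArrangement ι V} {p : ℕ} (s : 𝒜.Chain (p + 1)) (j : Fin p) :
    (s.erase (Fin.last p)).1 j ≠ 𝒜.whole := by
  intro h
  have h1 : s.1 (Fin.last p) < s.1 (Fin.castSucc j) := s.2 (Fin.castSucc_lt_last j)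
  have h2 : s.1 (Fin.castSucc j) = 𝒜.whole := by simpa [Chain.erase] using h
  exact absurd (𝒜.whole_le (s.1 (Fin.last p))) (not_le_of_gt (h2 ▸ h1))

open Classical in
/-- The cochain isomorphism `γ^p : C^{p-1}(F, ℂ) → C^p(L, ℂ_V)` followed by the inclusion into
`C^p(L, F^0)`, where `ℂ_V ⊆ F^0` is the skyscraper sheaf at `V`:
`(γ f)(X_0 > ⋯ > X_p) = f(X_0 > ⋯ > X_{p-1})` if `X_p = V`, and `0` otherwise. -/
def gam (𝒜 : HypArrangement ι V) (p : ℕ) (f : 𝒜.FCochain p) : 𝒜.Chain (p + 1) → 𝒜.OS := fun s =>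
  if s.last = 𝒜.whole then
    algebraMap ℂ 𝒜.OS (f ⟨s.erase (Fin.last p), erase_last_ne_whole s⟩)
  else 0

/-- The relation between an element `a ∈ A^r` and a cochain `f ∈ C^{r-1}(F, ℂ)` underlying the
composite of the connecting homomorphisms of the short exact sequences of sheaves
`0 → ker (d_λ | F^p) → F^p → ker (d_λ | F^{p+1}) → 0`, `p = r - 1, …, 0`. Start with the section
`c 0 ∈ C^0(L, F^r)` given by `a`; as long as `q < r`, lift `c q` along `d_λ` to some `b q` in
`C^q(L, F^{r-1-q})` and put `c (q + 1) = d (b q)`; end with `c r ∈ C^r(L, ℂ_V)`, the image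
of `f` under `γ`. -/
def IsZigzag [Fintype ι] (𝒜 : HypArrangement ι V) (lam : ι → ℂ) (r : ℕ) (a : 𝒜.OS)
    (f : 𝒜.FCochain r) : Prop :=
  ∃ b c : (q : ℕ) → 𝒜.Chain (q + 1) → 𝒜.OS,
    c 0 = 𝒜.globalSection a ∧
    (∀ q < r, b q ∈ 𝒜.sheafCochains (r - 1 - q) q ∧ 𝒜.dLam lam (b q) = c q ∧
      c (q + 1) = 𝒜.sheafD q (b q)) ∧
    c r = 𝒜.gam r f

/-- `φ` is Yuzvinsky's map `H^r(A, ω_λ ∧) → H^r(L, ℂ_V) = H̃^{r-1}(F, ℂ)`, the composite of the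
connecting homomorphisms: `φ x = y` exactly if `x` and `y` have representatives that are connected
by a zigzag. (This determines `φ`.) -/
def IsYuzvinskyMap [Fintype ι] (𝒜 : HypArrangement ι V) (lam : ι → ℂ) (r : ℕ)
    (φ : 𝒜.OSCohomology lam r → 𝒜.FCohomology r) : Prop :=
  ∀ x y, φ x = y ↔
    ∃ (a : 𝒜.osCocycles lam r) (f : LinearMap.ker (𝒜.fCoboundary r)),
      Submodule.Quotient.mk a = x ∧ Submodule.Quotient.mk f = y ∧ 𝒜.IsZigzag lam r a.1 f.1

/-- The linear map `υ : C^{r-1}(F, ℂ) → A^r` sending the cochain dual to a simplex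
`ξ = (X_1 > ⋯ > X_r)` to the flag form `ω_λ(X_1) ⋯ ω_λ(X_r)`. -/
def upsilon [Fintype ι] (𝒜 : HypArrangement ι V) (lam : ι → ℂ) (r : ℕ) :
    𝒜.FCochain r →ₗ[ℂ] 𝒜.OS where
  toFun f := ∑ ξ : 𝒜.Simplex r, f ξ • (List.ofFn fun j => 𝒜.ωAt lam (ξ.1.1 j)).prod
  map_add' f g := by simp [add_smul, Finset.sum_add_distrib]
  map_smul' c f := by simp [Finset.smul_sum, smul_smul]

end HypArrangement

end

/-! ### Flats, the Brieskorn decomposition and components of nonzero weight. -/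

noncomputable section

namespace HypArrangement

variable {ι V : Type*} [AddCommGroup V] [Module ℂ V]

/-! ### Codimension -/

/-! The spaces C^q(L, F^p) form a double complex with commuting differentials `dLam` and `sheafD`; a
zigzag is a staircase through it, and both directions are exact where the staircase needs it.

In the q-direction, C(L, F^p) resolves A^p. By Brieskorn's decomposition
(`eq_sum_restr_of_mem_span`) F^p is the direct sum, over the flats Y of codimension p, of sheaves
constant on {X ≥ Y} and zero elsewhere, and appending Y to a chain contracts the cochains of the
summand at Y (`exists_globalSection_eq`, `exists_sheafD_eq`).

In the p-direction, the stalk complex at X ≠ V is exact. The arrangement 𝒜_X has a component of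
nonzero weight (`exists_splits`), and contraction with the Euler field of that component is a
homotopy between zero and multiplication by the weight (`exists_ωAt_mul_eq`,
`eq_zero_of_ωAt_mul_eq_zero`). At V only F^0(V) = ℂ is left, so the kernel of d_λ on F^0 is ℂ_V
(`exists_gam_eq`).

Hence every cocycle of A^r starts a zigzag (`exists_isZigzag`), and one end of a zigzag is a
coboundary exactly when the other is (`IsZigzag.mem_fCoboundaries`, `IsZigzag.mem_osCoboundaries`).

The inverse comes from an explicit zigzag from ±υ(f) to f (`isZigzag_upsilon`). A flag of r elements
of L - {V} has codimensions r, …, 1; therefore d of a partial flag cochain sees only the last face,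
and the restriction to X_{q+1} selects the flags that pass through X_{q+1}. Step q costs the sign
(-1)^(q+1), in total (-1)^(1+⋯+r). The signed υ thus induces a bijection ψ on cohomology, and φ is
its inverse. -/

theorem codim_add_finrank [FiniteDimensional ℂ V] {𝒜 : HypArrangement ι V} (X : 𝒜.IntPoset) :
    X.codim + Module.finrank ℂ X.space.direction = Module.finrank ℂ V :=
  Nat.sub_add_cancel (Submodule.finrank_le _)

theorem codim_strictMono [FiniteDimensional ℂ V] (𝒜 : HypArrangement ι V) :
    StrictMono (IntPoset.codim : 𝒜.IntPoset → ℕ) := by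
  intro X Y h
  have h1 : Y.space < X.space := lt_of_le_of_ne (IntPoset.le_iff.1 h.le)
    fun e => h.ne' (IntPoset.space_injective e)
  have h2 := Submodule.finrank_lt_finrank_of_lt
    (AffineSubspace.direction_lt_of_nonempty h1 Y.2.1)
  have h3 := codim_add_finrank X
  have h4 := codim_add_finrank Y
  omega

theorem codim_le_rank [Finite ι] {𝒜 : HypArrangement ι V} (X : 𝒜.IntPoset) :
    X.codim ≤ 𝒜.rank :=
  le_ciSup (f := fun X : 𝒜.IntPoset => X.codim) (Set.finite_range _).bddAbove X

theorem eq_of_le_of_codim_le [FiniteDimensional ℂ V] {𝒜 : HypArrangement ι V} {X Y : 𝒜.IntPoset}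
    (h : X ≤ Y) (hc : Y.codim ≤ X.codim) : X = Y :=
  h.eq_of_not_lt fun hlt => absurd (𝒜.codim_strictMono hlt) (not_lt.2 hc)

theorem whole_lt_iff {𝒜 : HypArrangement ι V} {X : 𝒜.IntPoset} :
    𝒜.whole < X ↔ X ≠ 𝒜.whole :=
  ⟨fun h => h.ne', fun h => lt_of_le_of_ne (whole_le X) h.symm⟩

theorem codim_pos [FiniteDimensional ℂ V] {𝒜 : HypArrangement ι V} {X : 𝒜.IntPoset}
    (h : X ≠ 𝒜.whole) : 0 < X.codim := by
  have := 𝒜.codim_strictMono (whole_lt_iff.2 h)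
  omega

theorem eq_whole_of_codim_eq_zero [FiniteDimensional ℂ V] {𝒜 : HypArrangement ι V}
    {X : 𝒜.IntPoset} (h : X.codim = 0) : X = 𝒜.whole := by
  by_contra hX
  exact (codim_pos hX).ne' h

theorem Chain.codim_add_le [FiniteDimensional ℂ V] {𝒜 : HypArrangement ι V} {n : ℕ}
    (s : 𝒜.Chain n) {i j : Fin n} (h : i ≤ j) :
    (s.1 j).codim + (j - i : ℕ) ≤ (s.1 i).codim := by
  obtain ⟨i, hi⟩ := i
  obtain ⟨j, hj⟩ := j
  obtain ⟨k, rfl⟩ : ∃ k, j = i + k := ⟨j - i, by simp at h; omega⟩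
  clear h
  induction k with
  | zero => simp
  | succ k ih =>
    have h1 := ih (by omega)
    have h2 : (s.1 ⟨i + (k + 1), hj⟩).codim < (s.1 ⟨i + k, by omega⟩).codim :=
      𝒜.codim_strictMono (s.2 (by simp))
    simp only at h1 h2 ⊢
    omega

theorem Chain.codim_le [Finite ι] [FiniteDimensional ℂ V] {𝒜 : HypArrangement ι V} {n : ℕ}
    (s : 𝒜.Chain n) (j : Fin n) : (s.1 j).codim + j ≤ 𝒜.rank := by
  have h1 := s.codim_add_le (i := ⟨0, j.pos⟩) (j := j) (Fin.le_def.2 (Nat.zero_le _))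
  have h2 := codim_le_rank (s.1 ⟨0, j.pos⟩)
  simp only at h1
  omega

/-- The codimensions decrease strictly from at most r to at least 1 in r places, so all of them are
forced. The flag computations rest on this rigidity. -/
theorem Simplex.codim_eq [Finite ι] [FiniteDimensional ℂ V] {𝒜 : HypArrangement ι V}
    (ξ : 𝒜.Simplex 𝒜.rank) (j : Fin 𝒜.rank) : (ξ.1.1 j).codim + j = 𝒜.rank := by
  have h1 := ξ.1.codim_le j
  have hl : 𝒜.rank - 1 < 𝒜.rank := by have := j.2; omega
  have h2 := ξ.1.codim_add_le (i := j) (j := ⟨𝒜.rank - 1, hl⟩)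
    (Fin.le_def.2 (by simp only; omega))
  have h3 := codim_pos (ξ.2 ⟨𝒜.rank - 1, hl⟩)
  simp only at h2
  omega

theorem Chain.last_eq_whole [Finite ι] [FiniteDimensional ℂ V] {𝒜 : HypArrangement ι V}
    (s : 𝒜.Chain (𝒜.rank + 1)) : s.last = 𝒜.whole := by
  refine eq_whole_of_codim_eq_zero ?_
  have h := s.codim_le (Fin.last _)
  rw [Fin.val_last] at h
  unfold Chain.last
  omega

theorem isEmpty_simplex_rank_add_one [Finite ι] [FiniteDimensional ℂ V] (𝒜 : HypArrangement ι V) :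
    IsEmpty (𝒜.Simplex (𝒜.rank + 1)) :=
  ⟨fun ξ => ξ.2 (Fin.last _) ξ.1.last_eq_whole⟩

/-! ### Products of the generators -/

theorem loc_whole [Fintype ι] (𝒜 : HypArrangement ι V) : 𝒜.loc 𝒜.whole = ∅ := by
  refine Finset.eq_empty_of_forall_notMem fun i hi => 𝒜.linear_ne_zero i ?_
  have h : ∀ x, 𝒜.α i x = 0 := fun x => mem_loc.1 hi (AffineSubspace.mem_top ℂ V x)
  ext v
  have h1 := (𝒜.α i).linearMap_vsub v 0
  rw [h, h] at h1
  simpa using h1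

theorem loc_mono [Fintype ι] {𝒜 : HypArrangement ι V} {X Y : 𝒜.IntPoset} (h : X ≤ Y) :
    𝒜.loc X ⊆ 𝒜.loc Y :=
  fun _ hi => mem_loc.2 ((IntPoset.le_iff.1 h).trans (mem_loc.1 hi))

theorem linear_eq_zero_of_mem_loc [Fintype ι] {𝒜 : HypArrangement ι V} {X : 𝒜.IntPoset} {i : ι}
    (hi : i ∈ 𝒜.loc X) {v : V} (hv : v ∈ X.space.direction) : (𝒜.α i).linear v = 0 := by
  obtain ⟨z, hz⟩ := X.2.1
  have h1 : 𝒜.α i (v +ᵥ z) = 0 :=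
    mem_loc.1 hi (AffineSubspace.vadd_mem_of_mem_direction hv hz)
  rw [AffineMap.map_vadd, show 𝒜.α i z = 0 from mem_loc.1 hi hz] at h1
  simpa using h1

/-- At each point the product is a scalar multiple of the wedge of the linear parts. -/
theorem linearIndependent_of_prod_ne_zero (𝒜 : HypArrangement ι V) {p : ℕ} (w : Fin p → ι)
    (h : (List.ofFn fun j => 𝒜.ω (w j)).prod ≠ 0) :
    LinearIndependent ℂ fun j => (𝒜.α (w j)).linear := by
  by_contra hli
  refine h (𝒜.toForm_injective (funext fun x => ?_))
  refine (map_list_prod ((Pi.evalAlgHom ℂ _ x).comp 𝒜.toForm) _).trans ?_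
  rw [List.map_ofFn]
  have h2 : (⇑((Pi.evalAlgHom ℂ _ x).comp 𝒜.toForm) ∘ fun j => 𝒜.ω (w j)) =
      fun j => ExteriorAlgebra.ι ℂ ((𝒜.α (w j) x.1)⁻¹ • (𝒜.α (w j)).linear) := by
    funext j
    simp [toForm_ω, dlog]
  rw [h2, ← ExteriorAlgebra.ιMulti_apply, AlternatingMap.map_smul_univ,
    AlternatingMap.map_linearDependent _ _ hli, smul_zero, map_zero]
  rfl

theorem pi_surjective_of_linearIndependent [FiniteDimensional ℂ V] {p : ℕ}
    {l : Fin p → Module.Dual ℂ V} (h : LinearIndependent ℂ l) :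
    Function.Surjective (LinearMap.pi l : V →ₗ[ℂ] Fin p → ℂ) ∧
      Module.finrank ℂ (LinearMap.ker (LinearMap.pi l : V →ₗ[ℂ] Fin p → ℂ)) + p =
        Module.finrank ℂ V := by
  have hker : LinearMap.ker (LinearMap.pi l : V →ₗ[ℂ] Fin p → ℂ) =
      (Submodule.span ℂ (Set.range l)).dualCoannihilator := by
    ext v
    rw [LinearMap.mem_ker, Submodule.mem_dualCoannihilator]
    constructor
    · intro hv φ hφ
      induction hφ using Submodule.span_induction with
      | zero => simp
      | add x y _ _ hx hy => rw [LinearMap.add_apply, hx, hy, add_zero]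
      | smul c x _ hx => rw [LinearMap.smul_apply, hx, smul_zero]
      | mem x hx =>
        obtain ⟨j, rfl⟩ := hx
        exact congrFun hv j
    · intro hv
      funext j
      exact hv _ (Submodule.subset_span ⟨j, rfl⟩)
  have h1 := Subspace.finrank_add_finrank_dualCoannihilator_eq (Submodule.span ℂ (Set.range l))
  rw [← hker, finrank_span_eq_card h, Fintype.card_fin] at h1
  refine ⟨?_, by omega⟩
  have h2 := LinearMap.finrank_range_add_finrank_ker (LinearMap.pi l : V →ₗ[ℂ] Fin p → ℂ)
  rw [← LinearMap.range_eq_top]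
  refine Submodule.eq_top_of_finrank_eq ?_
  rw [Module.finrank_fin_fun]
  omega

/-- A nonzero product of `p` generators comes from `A(𝒜_Z)`, where `Z` is the intersection of the
corresponding hyperplanes, an element of `L` of codimension `p`. -/
theorem exists_flat_of_prod_ne_zero [Fintype ι] [FiniteDimensional ℂ V] (𝒜 : HypArrangement ι V)
    {p : ℕ} (w : Fin p → ι) (h : (List.ofFn fun j => 𝒜.ω (w j)).prod ≠ 0) :
    ∃ Z : 𝒜.IntPoset, Z.codim = p ∧ (∀ j, w j ∈ 𝒜.loc Z) ∧
      ∀ X : 𝒜.IntPoset, (∀ j, w j ∈ 𝒜.loc X) → Z ≤ X := by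
  obtain ⟨hs, hk⟩ := pi_surjective_of_linearIndependent (𝒜.linearIndependent_of_prod_ne_zero w h)
  -- Affine hyperplanes may have empty intersection, but independent linear parts take arbitrary
  -- values: prescribing -α(0) for each of them gives a common zero.
  obtain ⟨z, hz⟩ := hs fun j => - 𝒜.α (w j) 0
  have hz' : ∀ j, 𝒜.α (w j) z = 0 := by
    intro j
    have h1 : (𝒜.α (w j)).linear z = - 𝒜.α (w j) 0 := congrFun hz j
    have h2 := (𝒜.α (w j)).linearMap_vsub z 0
    simp only [vsub_eq_sub, sub_zero] at h2
    rw [h1] at h2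
    linear_combination -h2
  have hmem : ∀ x, x ∈ (⨅ i ∈ Set.range w, 𝒜.H i) ↔ ∀ j, 𝒜.α (w j) x = 0 := by
    intro x
    simp only [AffineSubspace.mem_iInf_iff, Set.forall_mem_range]
    rfl
  let Z : 𝒜.IntPoset := ⟨⨅ i ∈ Set.range w, 𝒜.H i, ⟨z, (hmem z).2 hz'⟩, Set.range w, rfl⟩
  have hZ : ∀ x, x ∈ Z.space ↔ ∀ j, 𝒜.α (w j) x = 0 := hmem
  have hloc : ∀ j, w j ∈ 𝒜.loc Z := fun j => mem_loc.2 fun x hx => (hZ x).1 hx j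
  refine ⟨Z, ?_, hloc, fun X hX => IntPoset.le_iff.2 fun x hx => (hZ x).2 fun j =>
    mem_loc.1 (hX j) hx⟩
  have hdir : Z.space.direction =
      LinearMap.ker (LinearMap.pi fun j => (𝒜.α (w j)).linear : V →ₗ[ℂ] Fin p → ℂ) := by
    ext v
    rw [LinearMap.mem_ker]
    constructor
    · intro hv
      funext j
      exact linear_eq_zero_of_mem_loc (hloc j) hv
    · intro hv
      have h1 : v +ᵥ z ∈ Z.space := by
        refine (hZ _).2 fun j => ?_
        have h3 : (𝒜.α (w j)).linear v = 0 := congrFun hv j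
        rw [AffineMap.map_vadd, h3, hz']
        simp
      simpa using AffineSubspace.vsub_mem_direction h1 ((hZ z).2 hz')
  have h5 := codim_add_finrank Z
  rw [hdir] at h5
  omega

theorem span_pow_induction [Fintype ι] (𝒜 : HypArrangement ι V) {S : Set ι} {p : ℕ}
    {P : 𝒜.OS → Prop} (zero : P 0) (add : ∀ a b, P a → P b → P (a + b))
    (smul : ∀ (c : ℂ) a, P a → P (c • a))
    (prod : ∀ w : Fin p → ι, (∀ j, w j ∈ S) → P (List.ofFn fun j => 𝒜.ω (w j)).prod)
    {a : 𝒜.OS} (ha : a ∈ Submodule.span ℂ (𝒜.ω '' S) ^ p) : P a := by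
  rw [Submodule.span_pow] at ha
  induction ha using Submodule.span_induction with
  | zero => exact zero
  | add x y _ _ hx hy => exact add x y hx hy
  | smul c x _ hx => exact smul c x hx
  | mem x hx =>
    obtain ⟨f, rfl⟩ := Set.mem_pow.1 hx
    choose w hw hwf using fun j => (f j).2
    simpa [hwf] using prod w hw

theorem prod_mem_stalk [Fintype ι] (𝒜 : HypArrangement ι V) {X : 𝒜.IntPoset} {p : ℕ}
    (w : Fin p → ι) (hw : ∀ j, w j ∈ 𝒜.loc X) :
    (List.ofFn fun j => 𝒜.ω (w j)).prod ∈ 𝒜.stalk p X := by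
  rw [stalk, Submodule.span_pow]
  refine Submodule.subset_span (Set.mem_pow.2 ⟨fun j => ⟨𝒜.ω (w j), ⟨w j, hw j, rfl⟩⟩, rfl⟩)

instance [Finite ι] (𝒜 : HypArrangement ι V) : Fintype 𝒜.IntPoset :=
  Fintype.ofFinite _

open Classical in
/-- Brieskorn decomposition. -/
theorem eq_sum_restr_of_mem_span [Fintype ι] [FiniteDimensional ℂ V] (𝒜 : HypArrangement ι V)
    {S : Set ι} {p : ℕ} {a : 𝒜.OS} (ha : a ∈ Submodule.span ℂ (𝒜.ω '' S) ^ p)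
    (T : 𝒜.IntPoset → Prop) (hT : ∀ (Z : 𝒜.IntPoset) (w : Fin p → ι), (∀ j, w j ∈ S) →
      (∀ X : 𝒜.IntPoset, (∀ j, w j ∈ 𝒜.loc X) → Z ≤ X) → T Z) :
    a = ∑ Y : 𝒜.IntPoset, if Y.codim = p ∧ T Y then 𝒜.restr Y a else 0 := by
  simp only [← Finset.sum_filter]
  refine 𝒜.span_pow_induction (P := fun a =>
    a = ∑ Y with Y.codim = p ∧ T Y, 𝒜.restr Y a) ?_ ?_ ?_ ?_ ha
  · simp
  · intro a b ha hb
    simp only [map_add, Finset.sum_add_distrib]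
    rw [← ha, ← hb]
  · intro c a ha
    simp only [map_smul, ← Finset.smul_sum]
    rw [← ha]
  · intro w hw
    by_cases h0 : (List.ofFn fun j => 𝒜.ω (w j)).prod = 0
    · simp [h0]
    · obtain ⟨Z, hZ, hZw, hZm⟩ := 𝒜.exists_flat_of_prod_ne_zero w h0
      have hm := 𝒜.prod_mem_stalk w hZw
      -- A monomial survives only at its own flat Z: a flat Y of the same codimension with Z ≤ Y
      -- equals Z, and any other is handled by `restr_of_not_le`.
      rw [Finset.sum_eq_single_of_mem Z (by simpa using ⟨hZ, hT Z w hw hZm⟩)]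
      · exact (𝒜.restr_of_le le_rfl hm).symm
      · intro Y hY hne
        subst hZ
        refine 𝒜.restr_of_not_le (fun hle => hne ?_) hm
        exact (eq_of_le_of_codim_le hle (Finset.mem_filter.1 hY).2.1.le).symm

open Classical in
theorem eq_sum_restr_of_mem_stalk [Fintype ι] [FiniteDimensional ℂ V] (𝒜 : HypArrangement ι V)
    {X : 𝒜.IntPoset} {p : ℕ} {a : 𝒜.OS} (ha : a ∈ 𝒜.stalk p X) :
    a = ∑ Y : 𝒜.IntPoset, if Y.codim = p ∧ Y ≤ X then 𝒜.restr Y a else 0 :=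
  𝒜.eq_sum_restr_of_mem_span ha (fun Y => Y ≤ X) fun _ _ hw hZ => hZ X hw

open Classical in
theorem eq_sum_restr_of_mem_grade [Fintype ι] [FiniteDimensional ℂ V] (𝒜 : HypArrangement ι V)
    {p : ℕ} {a : 𝒜.OS} (ha : a ∈ 𝒜.grade p) :
    a = ∑ Y : 𝒜.IntPoset, if Y.codim = p then 𝒜.restr Y a else 0 := by
  have h : a ∈ Submodule.span ℂ (𝒜.ω '' Set.univ) ^ p := by rwa [Set.image_univ]
  simpa using 𝒜.eq_sum_restr_of_mem_span h (fun _ => True) fun _ _ _ _ => trivial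

/-- The decomposition has no summands, as no flat has such a codimension. This makes every element
of A^r a cocycle. -/
theorem eq_zero_of_mem_grade_of_rank_lt [Fintype ι] [FiniteDimensional ℂ V]
    (𝒜 : HypArrangement ι V) {p : ℕ} {a : 𝒜.OS} (ha : a ∈ 𝒜.grade p) (hp : 𝒜.rank < p) :
    a = 0 := by
  rw [𝒜.eq_sum_restr_of_mem_grade ha]
  refine Finset.sum_eq_zero fun Y _ => if_neg ?_
  have := codim_le_rank Y
  omega

theorem stalk_le_grade [Fintype ι] (𝒜 : HypArrangement ι V) (p : ℕ) (X : 𝒜.IntPoset) :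
    𝒜.stalk p X ≤ 𝒜.grade p :=
  pow_le_pow_left' (Submodule.span_mono (Set.image_subset_range _ _)) p

/-! ### Splitting off a component of a flat -/

/-- A linear endomorphism `P` which fixes the linear parts of `α i`, `i ∈ S`, and kills those of the
other hyperplanes containing `X`. -/
def Splits [Fintype ι] (𝒜 : HypArrangement ι V) (X : 𝒜.IntPoset) (S : Finset ι)
    (P : V →ₗ[ℂ] V) : Prop :=
  S ⊆ 𝒜.loc X ∧ S.Nonempty ∧ (∀ i ∈ S, (𝒜.α i).linear ∘ₗ P = (𝒜.α i).linear) ∧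
    ∀ i ∈ 𝒜.loc X, i ∉ S → (𝒜.α i).linear ∘ₗ P = 0

/-- A component is closed under passing to its flat Y, so the hypothesis on dense flats can be
applied to Y. For every v the vector v - P v is a direction of Y; a hyperplane containing Y but
outside S would have a linear part vanishing on v - P v and on P v, hence everywhere. -/
theorem exists_loc_eq_of_splits [Fintype ι] (𝒜 : HypArrangement ι V) {X : 𝒜.IntPoset}
    {S : Finset ι} {P : V →ₗ[ℂ] V} (h : 𝒜.Splits X S P) :
    ∃ Y : 𝒜.IntPoset, 𝒜.loc Y = S := by
  obtain ⟨hS, hne, h1, h2⟩ := h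
  obtain ⟨x, hx⟩ := X.2.1
  have hmem : ∀ x, x ∈ (⨅ i ∈ (S : Set ι), 𝒜.H i) ↔ ∀ i ∈ S, 𝒜.α i x = 0 := by
    intro x
    simp only [AffineSubspace.mem_iInf_iff, Finset.mem_coe]
    rfl
  have hxS : ∀ i ∈ S, 𝒜.α i x = 0 := fun i hi => mem_loc.1 (hS hi) hx
  let Y : 𝒜.IntPoset := ⟨⨅ i ∈ (S : Set ι), 𝒜.H i, ⟨x, (hmem x).2 hxS⟩, S, rfl⟩
  have hY : ∀ x, x ∈ Y.space ↔ ∀ i ∈ S, 𝒜.α i x = 0 := hmem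
  have hYX : Y ≤ X := IntPoset.le_iff.2 fun z hz => (hY z).2 fun i hi => mem_loc.1 (hS hi) hz
  refine ⟨Y, Finset.Subset.antisymm (fun i hi => ?_) fun i hi => mem_loc.2 fun z hz =>
    (hY z).1 hz i hi⟩
  by_contra hiS
  refine 𝒜.linear_ne_zero i (LinearMap.ext fun v => ?_)
  have h3 : v - P v ∈ Y.space.direction := by
    have : (v - P v) +ᵥ x ∈ Y.space := by
      refine (hY _).2 fun j hj => ?_
      rw [AffineMap.map_vadd, hxS j hj, map_sub,
        show (𝒜.α j).linear (P v) = (𝒜.α j).linear v from LinearMap.congr_fun (h1 j hj) v]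
      simp
    simpa using AffineSubspace.vsub_mem_direction this ((hY x).2 hxS)
  have h4 := linear_eq_zero_of_mem_loc hi h3
  rw [map_sub, show (𝒜.α i).linear (P v) = 0 from
    LinearMap.congr_fun (h2 i (loc_mono hYX hi) hiS) v, sub_zero] at h4
  simpa using h4

theorem direction_H (𝒜 : HypArrangement ι V) (i : ι) (hne : (𝒜.H i : Set V).Nonempty) :
    (𝒜.H i).direction = LinearMap.ker (𝒜.α i).linear := by
  obtain ⟨x, hx⟩ := hne
  have hx' : 𝒜.α i x = 0 := hx
  ext v
  rw [LinearMap.mem_ker]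
  constructor
  · intro hv
    have h1 : 𝒜.α i (v +ᵥ x) = 0 := AffineSubspace.vadd_mem_of_mem_direction hv hx
    rw [AffineMap.map_vadd, hx'] at h1
    simpa using h1
  · intro hv
    have h1 : v +ᵥ x ∈ 𝒜.H i := by
      rw [mem_H, AffineMap.map_vadd, hv, hx']
      simp
    simpa using AffineSubspace.vsub_mem_direction h1 hx

/-- If no dense flat has weight zero, then every `𝒜_X`, `X ≠ V`, has a component of nonzero weight. -/
theorem exists_splits [Fintype ι] (𝒜 : HypArrangement ι V) (lam : ι → ℂ)
    (hlam : ∀ X : 𝒜.IntPoset, 𝒜.IsDense X → ∑ i ∈ 𝒜.loc X, lam i ≠ 0) {X : 𝒜.IntPoset}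
    (hX : X ≠ 𝒜.whole) : ∃ S P, 𝒜.Splits X S P ∧ ∑ i ∈ S, lam i ≠ 0 := by
  classical
  have hne : (𝒜.loc X).Nonempty := by
    rw [Finset.nonempty_iff_ne_empty]
    intro h
    refine hX (IntPoset.space_injective ?_)
    rw [space_eq_iInf_loc X, space_eq_iInf_loc 𝒜.whole, h, loc_whole]
  -- The set S will be a splitting of smallest cardinality; S = `𝒜.loc X` with the identity shows
  -- that one exists.
  have hex : ∃ n S P, 𝒜.Splits X S P ∧ S.card = n :=
    ⟨_, 𝒜.loc X, LinearMap.id, ⟨Finset.Subset.refl _, hne, fun _ _ => rfl,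
      fun i hi hi' => absurd hi hi'⟩, rfl⟩
  obtain ⟨S, P, hSP, hcard⟩ := Nat.find_spec hex
  refine ⟨S, P, hSP, ?_⟩
  obtain ⟨Y, hY⟩ := 𝒜.exists_loc_eq_of_splits hSP
  obtain ⟨hS, hSne, h1, h2⟩ := hSP
  have hYne : Y ≠ 𝒜.whole := by
    rintro rfl
    rw [loc_whole] at hY
    exact hSne.ne_empty hY.symm
  rw [← hY]
  refine hlam Y ⟨hYne, ?_⟩
  rintro ⟨V₁, V₂, hV, S₁, S₂, hS₁, hS₂, hunion, k₁, k₂⟩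
  rw [hY] at hunion
  obtain ⟨x, hx⟩ := X.2.1
  have hker : ∀ i ∈ S, (𝒜.H i).direction = LinearMap.ker (𝒜.α i).linear :=
    fun i hi => 𝒜.direction_H i ⟨x, mem_loc.1 (hS hi) hx⟩
  have hsub₁ : ∀ i ∈ S₁, i ∈ S := fun i hi =>
    Finset.mem_coe.1 (hunion ▸ Set.mem_union_left _ hi)
  have hsub₂ : ∀ i ∈ S₂, i ∈ S := fun i hi =>
    Finset.mem_coe.1 (hunion ▸ Set.mem_union_right _ hi)
  -- If the flat of S were decomposable, the projection Q onto V₁ along V₂ would refine the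
  -- splitting: P ∘ Q fixes the linear parts from S₁ and kills the rest, against minimality.
  let Q : V →ₗ[ℂ] V := V₁.subtype ∘ₗ V₁.projectionOnto V₂ hV
  have hQ₁ : ∀ v, Q v ∈ V₁ := fun v => Subtype.property _
  have hQ₂ : ∀ v, v - Q v ∈ V₂ := by
    intro v
    rw [← Submodule.ker_projectionOnto hV, LinearMap.mem_ker, map_sub, sub_eq_zero]
    exact (Submodule.projectionOnto_apply_left hV _).symm
  have q₁ : ∀ i ∈ S₁, (𝒜.α i).linear ∘ₗ Q = (𝒜.α i).linear := by
    intro i hi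
    ext v
    have := k₁ i hi (hQ₂ v)
    rw [hker i (hsub₁ i hi), LinearMap.mem_ker, map_sub, sub_eq_zero] at this
    exact this.symm
  have q₂ : ∀ i ∈ S₂, (𝒜.α i).linear ∘ₗ Q = 0 := by
    intro i hi
    ext v
    have := k₂ i hi (hQ₁ v)
    rwa [hker i (hsub₂ i hi), LinearMap.mem_ker] at this
  -- A linear part both fixed and killed by Q would be zero; since S₂ is nonempty, T is therefore a
  -- proper subset of S.
  have hdisj : ∀ i ∈ S₁, i ∉ S₂ := fun i hi hi' =>
    𝒜.linear_ne_zero i ((q₁ i hi).symm.trans (q₂ i hi'))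
  let T : Finset ι := S.filter (· ∈ S₁)
  have hTS : T ⊂ S := by
    obtain ⟨i, hi⟩ := hS₂
    refine (Finset.ssubset_iff_of_subset (Finset.filter_subset _ _)).2
      ⟨i, hsub₂ i hi, fun h => hdisj i (Finset.mem_filter.1 h).2 hi⟩
  have hT : 𝒜.Splits X T (P ∘ₗ Q) := by
    refine ⟨(Finset.filter_subset _ _).trans hS, ?_, ?_, ?_⟩
    · obtain ⟨i, hi⟩ := hS₁
      exact ⟨i, Finset.mem_filter.2 ⟨hsub₁ i hi, hi⟩⟩
    · intro i hi
      rw [Finset.mem_filter] at hi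
      rw [← LinearMap.comp_assoc, h1 i hi.1, q₁ i hi.2]
    · intro i hi hiT
      rw [← LinearMap.comp_assoc]
      by_cases hiS : i ∈ S
      · have : i ∈ S₂ := by
          have h3 : i ∈ S₁ ∪ S₂ := hunion ▸ Finset.mem_coe.2 hiS
          exact h3.resolve_left fun h => hiT (Finset.mem_filter.2 ⟨hiS, h⟩)
        rw [h1 i hiS, q₂ i this]
      · rw [h2 i hi hiS, LinearMap.zero_comp]
  have h5 := Nat.find_min' hex ⟨T, _, hT, rfl⟩
  have h6 := Finset.card_lt_card hTS
  omega

end HypArrangement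

end

/-! ### Euler contractions as homotopies on the stalks. -/

noncomputable section

namespace HypArrangement

variable {ι V : Type*} [AddCommGroup V] [Module ℂ V]

/-! ### Exactness of the stalk complexes -/

/-- Contraction of forms with the vector field `x ↦ P (x - y)`. -/
def eulerContract (𝒜 : HypArrangement ι V) (P : V →ₗ[ℂ] V) (y : V) : 𝒜.Form →ₗ[ℂ] 𝒜.Form where
  toFun φ x := CliffordAlgebra.contractLeft (Module.Dual.eval ℂ V (P (x.1 - y))) (φ x)
  map_add' φ ψ := by
    funext x
    exact map_add _ _ _
  map_smul' c φ := by
    funext x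
    exact LinearMap.map_smul _ c (φ x)

/-- The linear part of α_i takes the value c α_i(x) on the vector field, which cancels the pole of
ω_i. So ω_i contracts to the constant c, and contraction is an antiderivation. -/
theorem eulerContract_dlog_mul (𝒜 : HypArrangement ι V) (P : V →ₗ[ℂ] V) (y : V) (i : ι) (c : ℂ)
    (hy : 𝒜.α i y = 0) (hc : (𝒜.α i).linear ∘ₗ P = c • (𝒜.α i).linear) (φ : 𝒜.Form) :
    𝒜.eulerContract P y (𝒜.dlog i * φ) = c • φ - 𝒜.dlog i * 𝒜.eulerContract P y φ := by
  funext x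
  have hx := x.2 i
  have h1 : (𝒜.α i).linear (x.1 - y) = 𝒜.α i x.1 := by
    rw [← vsub_eq_sub, AffineMap.linearMap_vsub, hy]
    simp
  have h2 : (𝒜.α i).linear (P (x.1 - y)) = c * 𝒜.α i x.1 := by
    rw [← h1]
    exact LinearMap.congr_fun hc _
  change CliffordAlgebra.contractLeft _
      (((𝒜.α i x.1)⁻¹ • CliffordAlgebra.ι (0 : QuadraticForm ℂ (Module.Dual ℂ V))
        (𝒜.α i).linear) * φ x) =
    c • φ x - ((𝒜.α i x.1)⁻¹ • CliffordAlgebra.ι (0 : QuadraticForm ℂ (Module.Dual ℂ V))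
        (𝒜.α i).linear) * CliffordAlgebra.contractLeft _ (φ x)
  rw [smul_mul_assoc, map_smul, CliffordAlgebra.contractLeft_ι_mul, Module.Dual.eval_apply, h2,
    smul_sub, smul_smul, smul_mul_assoc]
  congr 2
  field_simp

theorem eulerContract_one (𝒜 : HypArrangement ι V) (P : V →ₗ[ℂ] V) (y : V) :
    𝒜.eulerContract P y 1 = 0 := by
  funext x
  exact CliffordAlgebra.contractLeft_one _ _

section Stalk

variable [Fintype ι] {𝒜 : HypArrangement ι V} {X : 𝒜.IntPoset} {S : Finset ι} {P : V →ₗ[ℂ] V}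
  {y : V}

theorem Splits.eulerContract_mul (h : 𝒜.Splits X S P) (hy : y ∈ X.space) {m : 𝒜.OS}
    (hm : m ∈ Submodule.span ℂ (𝒜.ω '' (𝒜.loc X : Set ι))) :
    ∃ c : ℂ, ∀ φ : 𝒜.Form, 𝒜.eulerContract P y (𝒜.toForm m * φ) =
      c • φ - 𝒜.toForm m * 𝒜.eulerContract P y φ := by
  induction hm using Submodule.span_induction with
  | zero => exact ⟨0, fun φ => by simp⟩
  | add a b _ _ ha hb =>
    obtain ⟨c, hc⟩ := ha
    obtain ⟨d, hd⟩ := hb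
    refine ⟨c + d, fun φ => ?_⟩
    rw [map_add, add_mul, map_add, hc, hd, add_smul, add_mul]
    abel
  | smul t a _ ha =>
    obtain ⟨c, hc⟩ := ha
    refine ⟨t * c, fun φ => ?_⟩
    rw [map_smul, smul_mul_assoc, map_smul, hc, smul_sub, smul_smul, smul_mul_assoc]
  | mem a ha =>
    obtain ⟨i, hi, rfl⟩ := ha
    by_cases hS : i ∈ S
    · exact ⟨1, 𝒜.eulerContract_dlog_mul P y i 1 (mem_loc.1 hi hy)
        (by rw [one_smul, h.2.2.1 i hS])⟩
    · exact ⟨0, 𝒜.eulerContract_dlog_mul P y i 0 (mem_loc.1 hi hy)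
        (by rw [zero_smul, h.2.2.2 i hi hS])⟩

/-- The homotopy formula: only the hyperplanes of S contribute to the contraction of ω_λ(X), which
is therefore the weight of S. -/
theorem Splits.eulerContract_ωAt_mul (h : 𝒜.Splits X S P) (hy : y ∈ X.space) (lam : ι → ℂ)
    (φ : 𝒜.Form) : 𝒜.eulerContract P y (𝒜.toForm (𝒜.ωAt lam X) * φ) =
      (∑ i ∈ S, lam i) • φ - 𝒜.toForm (𝒜.ωAt lam X) * 𝒜.eulerContract P y φ := by
  classical
  have h1 : ∀ i ∈ 𝒜.loc X, 𝒜.eulerContract P y (𝒜.dlog i * φ) =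
      (if i ∈ S then (1 : ℂ) else 0) • φ - 𝒜.dlog i * 𝒜.eulerContract P y φ := by
    intro i hi
    refine 𝒜.eulerContract_dlog_mul P y i _ (mem_loc.1 hi hy) ?_ φ
    split_ifs with hS
    · rw [one_smul, h.2.2.1 i hS]
    · rw [zero_smul, h.2.2.2 i hi hS]
  simp only [ωAt, map_sum, map_smul, toForm_ω, Finset.sum_mul, smul_mul_assoc]
  rw [Finset.sum_congr rfl fun i hi => by rw [h1 i hi, smul_sub, smul_smul],
    Finset.sum_sub_distrib, ← Finset.sum_smul]
  congr 2
  simp only [mul_ite, mul_one, mul_zero]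
  rw [← Finset.sum_filter, Finset.filter_mem_eq_inter, Finset.inter_eq_right.2 h.1]

theorem stalk_succ (𝒜 : HypArrangement ι V) (p : ℕ) (X : 𝒜.IntPoset) :
    𝒜.stalk (p + 1) X = Submodule.span ℂ (𝒜.ω '' (𝒜.loc X : Set ι)) * 𝒜.stalk p X :=
  pow_succ' _ _

/-- Contraction is defined on all forms on M; the homotopy is useful only because it maps A(𝒜_X) to
itself, lowering the degree by one. -/
theorem Splits.eulerContract_mem (h : 𝒜.Splits X S P) (hy : y ∈ X.space) (p : ℕ) :
    ∀ a ∈ 𝒜.stalk (p + 1) X, ∃ b ∈ 𝒜.stalk p X,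
      𝒜.toForm b = 𝒜.eulerContract P y (𝒜.toForm a) := by
  -- The inductive step is isolated because degree zero is special: there the contraction of a
  -- scalar vanishes, and there is no degree -1 to induct from.
  have key : ∀ q, (∀ m ∈ Submodule.span ℂ (𝒜.ω '' (𝒜.loc X : Set ι)), ∀ a ∈ 𝒜.stalk q X,
      ∃ b ∈ 𝒜.stalk q X, 𝒜.toForm b = 𝒜.toForm m * 𝒜.eulerContract P y (𝒜.toForm a)) →
      ∀ a ∈ 𝒜.stalk (q + 1) X, ∃ b ∈ 𝒜.stalk q X,
        𝒜.toForm b = 𝒜.eulerContract P y (𝒜.toForm a) := by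
    intro q hq a ha
    rw [stalk_succ] at ha
    induction ha using Submodule.mul_induction_on' with
    | mem_mul_mem m hm a ha =>
      obtain ⟨c, hc⟩ := h.eulerContract_mul hy hm
      obtain ⟨b, hb, hb'⟩ := hq m hm a ha
      refine ⟨c • a - b, sub_mem (Submodule.smul_mem _ _ ha) hb, ?_⟩
      rw [map_mul, hc, map_sub, map_smul, hb']
    | add a _ b _ ha hb =>
      obtain ⟨a', ha, ha'⟩ := ha
      obtain ⟨b', hb, hb'⟩ := hb
      exact ⟨a' + b', add_mem ha hb, by rw [map_add, map_add, map_add, ha', hb']⟩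
  induction p with
  | zero =>
    refine key 0 fun m _ a ha => ⟨0, zero_mem _, ?_⟩
    rw [stalk, pow_zero, Submodule.mem_one] at ha
    obtain ⟨c, rfl⟩ := ha
    rw [Algebra.algebraMap_eq_smul_one, map_smul, map_one, map_smul, eulerContract_one, smul_zero,
      mul_zero, map_zero]
  | succ p ih =>
    refine key (p + 1) fun m hm a ha => ?_
    obtain ⟨b, hb, hb'⟩ := ih a ha
    refine ⟨m * b, ?_, by rw [map_mul, hb']⟩
    rw [stalk_succ]
    exact Submodule.mul_mem_mul hm hb

end Stalk

variable [Fintype ι] {lam : ι → ℂ}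

theorem stalk_succ_whole (𝒜 : HypArrangement ι V) (p : ℕ) :
    𝒜.stalk (p + 1) 𝒜.whole = ⊥ := by
  rw [stalk_succ, loc_whole]
  simp

theorem mem_stalk_zero {𝒜 : HypArrangement ι V} {X : 𝒜.IntPoset} {a : 𝒜.OS} :
    a ∈ 𝒜.stalk 0 X ↔ ∃ c, algebraMap ℂ 𝒜.OS c = a := by
  rw [stalk, pow_zero, Submodule.mem_one]

/-- The stalk complexes are exact in positive degrees. -/
theorem exists_ωAt_mul_eq (𝒜 : HypArrangement ι V)
    (hlam : ∀ X : 𝒜.IntPoset, 𝒜.IsDense X → ∑ i ∈ 𝒜.loc X, lam i ≠ 0) (p : ℕ)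
    {X : 𝒜.IntPoset} {a : 𝒜.OS} (ha : a ∈ 𝒜.stalk (p + 1) X) (h0 : 𝒜.ωAt lam X * a = 0) :
    ∃ b ∈ 𝒜.stalk p X, 𝒜.ωAt lam X * b = a := by
  by_cases hX : X = 𝒜.whole
  · subst hX
    rw [stalk_succ_whole, Submodule.mem_bot] at ha
    exact ⟨0, zero_mem _, by rw [ha, mul_zero]⟩
  obtain ⟨S, P, hS, hne⟩ := 𝒜.exists_splits lam hlam hX
  obtain ⟨y, hy⟩ := X.2.1
  -- For a cocycle a the formula reads: weight times a equals ω_λ(X) times the contraction of a.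
  have h1 := hS.eulerContract_ωAt_mul hy lam (𝒜.toForm a)
  obtain ⟨b, hb, hb'⟩ := hS.eulerContract_mem hy p a ha
  rw [← map_mul, h0, map_zero, map_zero, ← hb', ← map_mul, ← map_smul] at h1
  have h2 := 𝒜.toForm_injective (sub_eq_zero.1 h1.symm)
  refine ⟨(∑ i ∈ S, lam i)⁻¹ • b, Submodule.smul_mem _ _ hb, ?_⟩
  rw [mul_smul_comm, ← h2, smul_smul, inv_mul_cancel₀ hne, one_smul]

/-- The stalk complexes outside of `V` are exact in degree zero. -/
theorem eq_zero_of_ωAt_mul_eq_zero (𝒜 : HypArrangement ι V)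
    (hlam : ∀ X : 𝒜.IntPoset, 𝒜.IsDense X → ∑ i ∈ 𝒜.loc X, lam i ≠ 0)
    {X : 𝒜.IntPoset} (hX : X ≠ 𝒜.whole) {a : 𝒜.OS} (ha : a ∈ 𝒜.stalk 0 X)
    (h0 : 𝒜.ωAt lam X * a = 0) : a = 0 := by
  obtain ⟨S, P, hS, hne⟩ := 𝒜.exists_splits lam hlam hX
  obtain ⟨y, hy⟩ := X.2.1
  have h1 := hS.eulerContract_ωAt_mul hy lam (𝒜.toForm a)
  obtain ⟨c, rfl⟩ := mem_stalk_zero.1 ha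
  rw [← map_mul, h0, map_zero, map_zero, Algebra.algebraMap_eq_smul_one, map_smul, map_one,
    map_smul, eulerContract_one, smul_zero, mul_zero, sub_zero, eq_comm, smul_eq_zero] at h1
  rw [Algebra.algebraMap_eq_smul_one]
  refine 𝒜.toForm_injective ?_
  rw [map_smul, map_one, map_zero]
  exact h1.resolve_left hne

theorem ωAt_mul_self (𝒜 : HypArrangement ι V) (lam : ι → ℂ) (X : 𝒜.IntPoset) :
    𝒜.ωAt lam X * 𝒜.ωAt lam X = 0 := by
  refine 𝒜.toForm_injective (funext fun x => ?_)
  have h : 𝒜.toForm (𝒜.ωAt lam X) x =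
      ExteriorAlgebra.ι ℂ (∑ i ∈ 𝒜.loc X, (lam i * (𝒜.α i x.1)⁻¹) • (𝒜.α i).linear) := by
    simp only [ωAt, map_sum, map_smul, toForm_ω, Finset.sum_apply, Pi.smul_apply, dlog, smul_smul]
  rw [map_mul, Pi.mul_apply, h, ExteriorAlgebra.ι_sq_zero, map_zero]
  rfl

end HypArrangement

end

/-! ### The double complex of sheaf cochains and its exactness. -/

noncomputable section

namespace HypArrangement

variable {ι V : Type*} [AddCommGroup V] [Module ℂ V]

/-! ### Chains -/

theorem Chain.ext {𝒜 : HypArrangement ι V} {n : ℕ} {s t : 𝒜.Chain n}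
    (h : ∀ k, s.1 k = t.1 k) : s = t :=
  Subtype.ext (funext h)

theorem Chain.last_erase_castSucc {𝒜 : HypArrangement ι V} {n : ℕ} (s : 𝒜.Chain (n + 2))
    (j : Fin (n + 1)) : (s.erase j.castSucc).last = s.last := by
  change s.1 (j.castSucc.succAbove (Fin.last n)) = s.1 (Fin.last (n + 1))
  rw [Fin.succAbove_ne_last_last (Fin.castSucc_ne_last j)]

theorem Chain.last_lt_last_erase_last {𝒜 : HypArrangement ι V} {n : ℕ} (s : 𝒜.Chain (n + 2)) :
    s.last < (s.erase (Fin.last (n + 1))).last := by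
  refine s.2 ?_
  rw [Fin.succAbove_last]
  exact Fin.castSucc_lt_last _

theorem Chain.last_le_last_erase {𝒜 : HypArrangement ι V} {n : ℕ} (s : 𝒜.Chain (n + 2))
    (j : Fin (n + 2)) : s.last ≤ (s.erase j).last := by
  induction j using Fin.lastCases with
  | last => exact s.last_lt_last_erase_last.le
  | cast j => rw [s.last_erase_castSucc]

/-- The simplicial identity, written for the pairing of double faces that cancels the terms of d².
-/
theorem Chain.erase_erase {𝒜 : HypArrangement ι V} {n : ℕ} (s : 𝒜.Chain (n + 2))
    (i : Fin (n + 2)) (j : Fin (n + 1)) :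
    (s.erase (i.succAbove j)).erase (j.predAbove i) = (s.erase i).erase j :=
  Chain.ext fun k => congrArg s.1 (Fin.succAbove_succAbove_succAbove_predAbove i j k)

/-- Append a smaller element to a chain. -/
def Chain.snoc {𝒜 : HypArrangement ι V} {n : ℕ} (s : 𝒜.Chain (n + 1)) (Y : 𝒜.IntPoset)
    (h : Y < s.last) : 𝒜.Chain (n + 2) :=
  ⟨Fin.snoc (α := fun _ => 𝒜.IntPoset) s.1 Y, by
    rw [Fin.strictAnti_iff_succ_lt]
    intro i
    induction i using Fin.lastCases with
    | last =>
      rw [Fin.succ_last, Fin.snoc_last, Fin.snoc_castSucc]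
      exact h
    | cast i =>
      rw [Fin.succ_castSucc, Fin.snoc_castSucc, Fin.snoc_castSucc]
      exact s.2 Fin.castSucc_lt_succ⟩

theorem Chain.last_snoc {𝒜 : HypArrangement ι V} {n : ℕ} (s : 𝒜.Chain (n + 1)) (Y : 𝒜.IntPoset)
    (h : Y < s.last) : (s.snoc Y h).last = Y :=
  Fin.snoc_last (α := fun _ => 𝒜.IntPoset) Y s.1

theorem Chain.erase_last_snoc {𝒜 : HypArrangement ι V} {n : ℕ} (s : 𝒜.Chain (n + 1))
    (Y : 𝒜.IntPoset) (h : Y < s.last) : (s.snoc Y h).erase (Fin.last (n + 1)) = s := by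
  refine Chain.ext fun k => ?_
  change (s.snoc Y h).1 ((Fin.last (n + 1)).succAbove k) = _
  rw [Fin.succAbove_last]
  exact Fin.snoc_castSucc (α := fun _ => 𝒜.IntPoset) Y s.1 k

theorem Chain.erase_castSucc_snoc {𝒜 : HypArrangement ι V} {n : ℕ} (s : 𝒜.Chain (n + 2))
    (Y : 𝒜.IntPoset) (h : Y < s.last) (j : Fin (n + 2)) :
    (s.snoc Y h).erase j.castSucc = (s.erase j).snoc Y (h.trans_le (s.last_le_last_erase j)) := by
  refine Chain.ext fun k => ?_
  change Fin.snoc (α := fun _ => 𝒜.IntPoset) s.1 Y (j.castSucc.succAbove k) =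
    Fin.snoc (α := fun _ => 𝒜.IntPoset) (s.1 ∘ j.succAbove) Y k
  induction k using Fin.lastCases with
  | last => rw [Fin.succAbove_ne_last_last (Fin.castSucc_ne_last j), Fin.snoc_last, Fin.snoc_last]
  | cast k => rw [Fin.castSucc_succAbove_castSucc, Fin.snoc_castSucc, Fin.snoc_castSucc]; rfl

theorem Chain.snoc_erase_last {𝒜 : HypArrangement ι V} {n : ℕ} (s : 𝒜.Chain (n + 2)) :
    (s.erase (Fin.last (n + 1))).snoc s.last s.last_lt_last_erase_last = s := by
  refine Chain.ext fun k => ?_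
  change Fin.snoc (α := fun _ => 𝒜.IntPoset) (s.1 ∘ (Fin.last (n + 1)).succAbove) s.last k = _
  induction k using Fin.lastCases with
  | last => exact Fin.snoc_last (α := fun _ => 𝒜.IntPoset) _ _
  | cast k => rw [Fin.snoc_castSucc, Fin.succAbove_last]; rfl

/-- The chain with one element. -/
def Chain.single {𝒜 : HypArrangement ι V} (X : 𝒜.IntPoset) : 𝒜.Chain 1 :=
  ⟨fun _ => X, fun i j h => absurd h (by simp [Subsingleton.elim i j])⟩

theorem Chain.eq_single_last {𝒜 : HypArrangement ι V} (s : 𝒜.Chain 1) : s = single s.last :=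
  Chain.ext fun k => congrArg s.1 (Subsingleton.elim k _)

theorem Chain.erase_castSucc_snoc_one {𝒜 : HypArrangement ι V} (s : 𝒜.Chain 1)
    (Y : 𝒜.IntPoset) (h : Y < s.last) (j : Fin 1) :
    (s.snoc Y h).erase j.castSucc = single Y := by
  rw [Chain.eq_single_last ((s.snoc Y h).erase j.castSucc), Chain.last_erase_castSucc,
    Chain.last_snoc]

theorem Chain.erase_castSucc_erase_last {𝒜 : HypArrangement ι V} {n : ℕ} (s : 𝒜.Chain (n + 2))
    (j : Fin (n + 1)) :
    (s.erase j.castSucc).erase (Fin.last n) = (s.erase (Fin.last (n + 1))).erase j := by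
  have h := s.erase_erase (Fin.last (n + 1)) j
  rwa [Fin.succAbove_last, Fin.predAbove_right_last] at h

/-- The chain of `L` obtained from a simplex by appending `V`. -/
def Simplex.toChain {𝒜 : HypArrangement ι V} {q : ℕ} (ξ : 𝒜.Simplex q) : 𝒜.Chain (q + 1) :=
  ⟨Fin.snoc (α := fun _ => 𝒜.IntPoset) ξ.1.1 𝒜.whole, by
    intro i j hij
    induction j using Fin.lastCases with
    | last =>
      obtain ⟨i, rfl⟩ := Fin.exists_castSucc_eq.2 hij.ne
      rw [Fin.snoc_last, Fin.snoc_castSucc]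
      exact whole_lt_iff.2 (ξ.2 i)
    | cast j =>
      obtain ⟨i, rfl⟩ := Fin.exists_castSucc_eq.2 (hij.trans (Fin.castSucc_lt_last j)).ne
      rw [Fin.snoc_castSucc, Fin.snoc_castSucc]
      exact ξ.1.2 (by simpa using hij)⟩

theorem Simplex.last_toChain {𝒜 : HypArrangement ι V} {q : ℕ} (ξ : 𝒜.Simplex q) : ξ.toChain.last = 𝒜.whole :=
  Fin.snoc_last (α := fun _ => 𝒜.IntPoset) _ _

theorem Simplex.erase_last_toChain {𝒜 : HypArrangement ι V} {q : ℕ} (ξ : 𝒜.Simplex q) : ξ.toChain.erase (Fin.last q) = ξ.1 := by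
  refine Chain.ext fun k => ?_
  change ξ.toChain.1 ((Fin.last q).succAbove k) = _
  rw [Fin.succAbove_last]
  exact Fin.snoc_castSucc (α := fun _ => 𝒜.IntPoset) _ _ k

theorem gam_toChain {𝒜 : HypArrangement ι V} {q : ℕ} (f : 𝒜.FCochain q) (ξ : 𝒜.Simplex q) :
    𝒜.gam q f ξ.toChain = algebraMap ℂ 𝒜.OS (f ξ) := by
  rw [gam, if_pos ξ.last_toChain]
  congr 2
  exact Subtype.ext ξ.erase_last_toChain

theorem gam_sub {𝒜 : HypArrangement ι V} {q : ℕ} (f g : 𝒜.FCochain q) : 𝒜.gam q (f - g) = 𝒜.gam q f - 𝒜.gam q g := by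
  funext s
  simp only [gam, Pi.sub_apply]
  split_ifs
  · exact map_sub _ _ _
  · rw [sub_zero]

/-! ### Restriction -/

theorem algHom_ext_ω {𝒜 : HypArrangement ι V} {B : Type*} [Ring B] [Algebra ℂ B]
    {f g : 𝒜.OS →ₐ[ℂ] B} (h : ∀ i, f (𝒜.ω i) = g (𝒜.ω i)) : f = g := by
  have h1 : f.comp (FreeAlgebra.lift ℂ 𝒜.ω) = g.comp (FreeAlgebra.lift ℂ 𝒜.ω) := by
    ext i
    simp [h]
  ext a
  obtain ⟨b, rfl⟩ := 𝒜.lift_ω_surjective a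
  exact DFunLike.congr_fun h1 b

section Restr

variable [Fintype ι]

theorem restr_restr (𝒜 : HypArrangement ι V) {Y Z : 𝒜.IntPoset} (h : Z ≤ Y) (a : 𝒜.OS) :
    𝒜.restr Z (𝒜.restr Y a) = 𝒜.restr Z a := by
  have h1 : (𝒜.restr Z).comp (𝒜.restr Y) = 𝒜.restr Z := by
    refine algHom_ext_ω fun i => ?_
    rw [AlgHom.comp_apply, restr_ω]
    split_ifs with hi
    · rfl
    · rw [map_zero, restr_ω, if_neg fun h2 => hi (loc_mono h h2)]
  exact DFunLike.congr_fun h1 a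

theorem restr_mem_stalk (𝒜 : HypArrangement ι V) {p : ℕ} (Z : 𝒜.IntPoset) {a : 𝒜.OS}
    (ha : a ∈ 𝒜.grade p) : 𝒜.restr Z a ∈ 𝒜.stalk p Z := by
  have h1 : (Submodule.span ℂ (Set.range 𝒜.ω)).map (𝒜.restr Z).toLinearMap ≤
      Submodule.span ℂ (𝒜.ω '' (𝒜.loc Z : Set ι)) := by
    rw [Submodule.map_span_le]
    rintro _ ⟨i, rfl⟩
    rw [AlgHom.toLinearMap_apply, restr_ω]
    split_ifs with hi
    · exact Submodule.subset_span ⟨i, hi, rfl⟩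
    · exact zero_mem _
  refine pow_le_pow_left' h1 p ?_
  rw [← Submodule.map_pow]
  exact ⟨a, ha, rfl⟩

theorem stalk_mono (𝒜 : HypArrangement ι V) (p : ℕ) {Y Z : 𝒜.IntPoset} (h : Z ≤ Y) :
    𝒜.stalk p Z ≤ 𝒜.stalk p Y :=
  pow_le_pow_left' (Submodule.span_mono (Set.image_mono (loc_mono h))) p

theorem restr_ωAt (𝒜 : HypArrangement ι V) (lam : ι → ℂ) {Y Z : 𝒜.IntPoset} (h : Z ≤ Y) :
    𝒜.restr Z (𝒜.ωAt lam Y) = 𝒜.ωAt lam Z := by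
  classical
  simp only [ωAt, map_sum, map_smul, restr_ω, smul_ite, smul_zero]
  rw [← Finset.sum_filter, Finset.filter_mem_eq_inter, Finset.inter_eq_right.2 (loc_mono h)]

theorem restr_ωTotal (𝒜 : HypArrangement ι V) (lam : ι → ℂ) (Z : 𝒜.IntPoset) :
    𝒜.restr Z (𝒜.ωTotal lam) = 𝒜.ωAt lam Z := by
  classical
  simp only [ωTotal, ωAt, map_sum, map_smul, restr_ω, smul_ite, smul_zero]
  rw [← Finset.sum_filter, Finset.filter_mem_eq_inter, Finset.univ_inter]

theorem ωAt_mem_span (𝒜 : HypArrangement ι V) (lam : ι → ℂ) (X : 𝒜.IntPoset) :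
    𝒜.ωAt lam X ∈ Submodule.span ℂ (𝒜.ω '' (𝒜.loc X : Set ι)) :=
  sum_mem fun i hi => Submodule.smul_mem _ _ (Submodule.subset_span ⟨i, hi, rfl⟩)

theorem ωAt_mul_mem_stalk (𝒜 : HypArrangement ι V) (lam : ι → ℂ) {X : 𝒜.IntPoset} {p : ℕ}
    {a : 𝒜.OS} (ha : a ∈ 𝒜.stalk p X) : 𝒜.ωAt lam X * a ∈ 𝒜.stalk (p + 1) X := by
  rw [stalk_succ]
  exact Submodule.mul_mem_mul (𝒜.ωAt_mem_span lam X) ha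

theorem ωTotal_mul_mem_grade (𝒜 : HypArrangement ι V) (lam : ι → ℂ) {p : ℕ}
    {a : 𝒜.OS} (ha : a ∈ 𝒜.grade p) : 𝒜.ωTotal lam * a ∈ 𝒜.grade (p + 1) := by
  rw [grade, pow_succ']
  exact Submodule.mul_mem_mul (sum_mem fun i _ => Submodule.smul_mem _ _
    (Submodule.subset_span ⟨i, rfl⟩)) ha

theorem ωAt_whole (𝒜 : HypArrangement ι V) (lam : ι → ℂ) : 𝒜.ωAt lam 𝒜.whole = 0 := by
  rw [ωAt, loc_whole, Finset.sum_empty]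

end Restr

/-! ### The double complex -/

section Double

variable [Fintype ι] {𝒜 : HypArrangement ι V} {lam : ι → ℂ} {p q : ℕ}

theorem mem_sheafCochains {b : 𝒜.Chain (q + 1) → 𝒜.OS} :
    b ∈ 𝒜.sheafCochains p q ↔ ∀ s : 𝒜.Chain (q + 1), b s ∈ 𝒜.stalk p s.last := by
  simp [sheafCochains, Submodule.mem_pi]

theorem sheafD_sub (b b' : 𝒜.Chain (q + 1) → 𝒜.OS) :
    𝒜.sheafD q (b - b') = 𝒜.sheafD q b - 𝒜.sheafD q b' := by
  funext s
  simp only [sheafD, Pi.sub_apply, map_sub, smul_sub, Finset.sum_sub_distrib]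
  abel

theorem dLam_sub (b b' : 𝒜.Chain (q + 1) → 𝒜.OS) :
    𝒜.dLam lam (b - b') = 𝒜.dLam lam b - 𝒜.dLam lam b' := by
  funext s
  simp only [dLam, Pi.sub_apply, mul_sub]

theorem dLam_mem {b : 𝒜.Chain (q + 1) → 𝒜.OS} (hb : b ∈ 𝒜.sheafCochains p q) :
    𝒜.dLam lam b ∈ 𝒜.sheafCochains (p + 1) q :=
  mem_sheafCochains.2 fun s => 𝒜.ωAt_mul_mem_stalk lam (mem_sheafCochains.1 hb s)

theorem dLam_dLam (b : 𝒜.Chain (q + 1) → 𝒜.OS) : 𝒜.dLam lam (𝒜.dLam lam b) = 0 := by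
  funext s
  simp only [dLam]
  rw [← mul_assoc, ωAt_mul_self, zero_mul, Pi.zero_apply]

theorem sheafD_mem {b : 𝒜.Chain (q + 1) → 𝒜.OS} (hb : b ∈ 𝒜.sheafCochains p q) :
    𝒜.sheafD q b ∈ 𝒜.sheafCochains p (q + 1) := by
  rw [mem_sheafCochains] at hb ⊢
  intro s
  refine add_mem (sum_mem fun j _ => Submodule.smul_mem _ _ ?_) (Submodule.smul_mem _ _ ?_)
  · have := hb (s.erase j.castSucc)
    rwa [s.last_erase_castSucc] at this
  · exact 𝒜.restr_mem_stalk _ (𝒜.stalk_le_grade _ _ (hb _))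

/-- The restriction to a smaller flat Z sends ω_λ(Y) to ω_λ(Z), so d_λ is a map of sheaves. -/
theorem sheafD_dLam (b : 𝒜.Chain (q + 1) → 𝒜.OS) :
    𝒜.sheafD q (𝒜.dLam lam b) = 𝒜.dLam lam (𝒜.sheafD q b) := by
  funext s
  simp only [sheafD, dLam, mul_add, Finset.mul_sum, mul_smul_comm, map_mul,
    s.last_erase_castSucc]
  rw [𝒜.restr_ωAt lam s.last_lt_last_erase_last.le]

/-- On the first terms the restriction is the identity; inserting it makes all faces look alike, as
the cancellation in d² requires. -/
theorem sheafD_apply {b : 𝒜.Chain (q + 1) → 𝒜.OS} (hb : b ∈ 𝒜.sheafCochains p q)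
    (s : 𝒜.Chain (q + 2)) : 𝒜.sheafD q b s =
      ∑ j : Fin (q + 2), (-1 : ℂ) ^ (j : ℕ) • 𝒜.restr s.last (b (s.erase j)) := by
  rw [Fin.sum_univ_castSucc, sheafD]
  congr 1
  refine Finset.sum_congr rfl fun j _ => ?_
  have h := mem_sheafCochains.1 hb (s.erase j.castSucc)
  rw [s.last_erase_castSucc] at h
  rw [𝒜.restr_of_le le_rfl h, Fin.val_castSucc]

theorem sheafD_sheafD {b : 𝒜.Chain (q + 1) → 𝒜.OS} (hb : b ∈ 𝒜.sheafCochains p q) :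
    𝒜.sheafD (q + 1) (𝒜.sheafD q b) = 0 := by
  funext s
  rw [sheafD_apply (sheafD_mem hb), Pi.zero_apply]
  simp only [sheafD_apply hb, map_sum, map_smul, Finset.smul_sum, smul_smul,
    𝒜.restr_restr (s.last_le_last_erase _), ← pow_add]
  rw [← Finset.sum_product']
  refine Finset.sum_involution (fun x _ => (x.1.succAbove x.2, x.2.predAbove x.1)) ?_ ?_ ?_ ?_
  · rintro ⟨i, j⟩ _
    simp only
    rw [s.erase_erase, Fin.neg_one_pow_succAbove_add_predAbove, neg_smul, add_neg_cancel]
  · rintro ⟨i, j⟩ _ _ h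
    exact Fin.succAbove_ne i j (Prod.ext_iff.1 h).1
  · intros
    simp
  · rintro ⟨i, j⟩ _
    simp only
    rw [Fin.succAbove_succAbove_predAbove, Fin.predAbove_predAbove_succAbove]

theorem exists_dLam_eq (hlam : ∀ X : 𝒜.IntPoset, 𝒜.IsDense X → ∑ i ∈ 𝒜.loc X, lam i ≠ 0)
    {b : 𝒜.Chain (q + 1) → 𝒜.OS} (hb : b ∈ 𝒜.sheafCochains (p + 1) q)
    (h0 : 𝒜.dLam lam b = 0) : ∃ e ∈ 𝒜.sheafCochains p q, 𝒜.dLam lam e = b := by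
  have h : ∀ s : 𝒜.Chain (q + 1), ∃ e ∈ 𝒜.stalk p s.last, 𝒜.ωAt lam s.last * e = b s :=
    fun s => 𝒜.exists_ωAt_mul_eq hlam p (mem_sheafCochains.1 hb s) (congrFun h0 s)
  choose e he he' using h
  exact ⟨e, mem_sheafCochains.2 he, funext he'⟩

/-! ### The cochains of the skyscraper sheaf -/

theorem gam_mem (f : 𝒜.FCochain q) : 𝒜.gam q f ∈ 𝒜.sheafCochains 0 q := by
  refine mem_sheafCochains.2 fun s => mem_stalk_zero.2 ?_
  rw [gam]
  split_ifs with h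
  · exact ⟨_, rfl⟩
  · exact ⟨0, map_zero _⟩

theorem dLam_gam (f : 𝒜.FCochain q) : 𝒜.dLam lam (𝒜.gam q f) = 0 := by
  funext s
  rw [dLam, gam, Pi.zero_apply]
  split_ifs with h
  · rw [h, ωAt_whole, zero_mul]
  · rw [mul_zero]

instance : Nontrivial 𝒜.OS := by
  -- A generic point of V lies on no hyperplane, so M is nonempty and the form 1 is not zero.
  obtain ⟨y, -, hy⟩ := 𝒜.exists_generic 𝒜.whole
  rw [loc_whole] at hy
  refine ⟨⟨1, 0, fun h => ?_⟩⟩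
  have h1 : 𝒜.toForm 1 = 𝒜.toForm 0 := congrArg _ h
  rw [map_one, map_zero] at h1
  exact one_ne_zero (congrFun h1 ⟨y, fun i => by simp [hy]⟩)

theorem gam_injective : Function.Injective (𝒜.gam q) := by
  intro f g h
  funext ξ
  have h1 := congrFun h ξ.toChain
  rw [gam_toChain, gam_toChain] at h1
  exact (algebraMap ℂ 𝒜.OS).injective h1

/-- The face with the restriction drops out: its last element lies strictly above another one, hence
is not V. -/
theorem sheafD_gam (f : 𝒜.FCochain q) :
    𝒜.sheafD q (𝒜.gam q f) = 𝒜.gam (q + 1) (𝒜.fCoboundary q f) := by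
  funext s
  have h0 : (s.erase (Fin.last (q + 1))).last ≠ 𝒜.whole :=
    ((whole_le _).trans_lt s.last_lt_last_erase_last).ne'
  rw [sheafD, gam, if_neg h0, map_zero, smul_zero, add_zero]
  by_cases h : s.last = 𝒜.whole
  · rw [gam, if_pos h]
    simp only [fCoboundary, LinearMap.coe_mk, AddHom.coe_mk, map_sum]
    refine Finset.sum_congr rfl fun j _ => ?_
    rw [gam, if_pos (by rw [s.last_erase_castSucc, h]), map_mul, Algebra.smul_def]
    congr 3
    exact Subtype.ext (s.erase_castSucc_erase_last j)
  · rw [gam, if_neg h]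
    refine Finset.sum_eq_zero fun j _ => ?_
    rw [gam, if_neg (by rwa [s.last_erase_castSucc]), smul_zero]

/-- Off V the map d_λ is injective on constants, so a d_λ-closed cochain with values in F^0 lives on
the chains ending in V. -/
theorem exists_gam_eq (hlam : ∀ X : 𝒜.IntPoset, 𝒜.IsDense X → ∑ i ∈ 𝒜.loc X, lam i ≠ 0)
    {b : 𝒜.Chain (q + 1) → 𝒜.OS} (hb : b ∈ 𝒜.sheafCochains 0 q) (h0 : 𝒜.dLam lam b = 0) :
    ∃ f, 𝒜.gam q f = b := by
  choose c hc using fun s => mem_stalk_zero.1 (mem_sheafCochains.1 hb s)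
  refine ⟨fun ξ => c ξ.toChain, funext fun s => ?_⟩
  rw [gam]
  split_ifs with h
  · rw [← hc s]
    congr 2
    refine Chain.ext fun k => ?_
    change Fin.snoc (α := fun _ => 𝒜.IntPoset) (s.1 ∘ (Fin.last q).succAbove) 𝒜.whole k = _
    induction k using Fin.lastCases with
    | last => rw [Fin.snoc_last]; exact h.symm
    | cast k => rw [Fin.snoc_castSucc, Fin.succAbove_last]; rfl
  · exact (𝒜.eq_zero_of_ωAt_mul_eq_zero hlam h (mem_sheafCochains.1 hb s) (congrFun h0 s)).symm

/-! ### Global sections and the exactness of `C(L, F^p)` -/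

theorem globalSection_mem {a : 𝒜.OS} (ha : a ∈ 𝒜.grade p) :
    𝒜.globalSection a ∈ 𝒜.sheafCochains p 0 :=
  mem_sheafCochains.2 fun _ => 𝒜.restr_mem_stalk _ ha

theorem dLam_globalSection (a : 𝒜.OS) :
    𝒜.dLam lam (𝒜.globalSection a) = 𝒜.globalSection (𝒜.ωTotal lam * a) := by
  funext s
  rw [dLam, globalSection, globalSection, map_mul, restr_ωTotal]

theorem sheafD_globalSection (a : 𝒜.OS) : 𝒜.sheafD 0 (𝒜.globalSection a) = 0 := by
  funext s
  simp only [sheafD, globalSection, s.last_erase_castSucc,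
    𝒜.restr_restr s.last_lt_last_erase_last.le]
  simp

theorem globalSection_injOn [FiniteDimensional ℂ V] {a b : 𝒜.OS} (ha : a ∈ 𝒜.grade p)
    (hb : b ∈ 𝒜.grade p) (h : 𝒜.globalSection a = 𝒜.globalSection b) : a = b := by
  classical
  have h1 : ∀ Y, 𝒜.restr Y a = 𝒜.restr Y b := fun Y => congrFun h (Chain.single Y)
  rw [𝒜.eq_sum_restr_of_mem_grade ha, 𝒜.eq_sum_restr_of_mem_grade hb]
  simp only [h1]

/-- The section is assembled from the values of b at the flats of codimension p. The cocycle
condition on X > Y says that b(X) restricts to b(Y), so both have the same Brieskorn components. -/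
theorem exists_globalSection_eq [FiniteDimensional ℂ V] {b : 𝒜.Chain 1 → 𝒜.OS}
    (hb : b ∈ 𝒜.sheafCochains p 0) (h0 : 𝒜.sheafD 0 b = 0) :
    ∃ a ∈ 𝒜.grade p, 𝒜.globalSection a = b := by
  classical
  rw [mem_sheafCochains] at hb
  refine ⟨∑ Y : 𝒜.IntPoset, if Y.codim = p then b (Chain.single Y) else 0, sum_mem fun Y _ => ?_,
    funext fun s => ?_⟩
  · split_ifs
    · exact 𝒜.stalk_le_grade _ _ (hb _)
    · exact zero_mem _
  · rw [globalSection, map_sum, 𝒜.eq_sum_restr_of_mem_stalk (hb s)]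
    refine Finset.sum_congr rfl fun Y _ => ?_
    by_cases hY : Y.codim = p
    · have hbY : b (Chain.single Y) ∈ 𝒜.stalk Y.codim Y := hY ▸ hb (Chain.single Y)
      by_cases hle : Y ≤ s.last
      · rw [if_pos hY, if_pos ⟨hY, hle⟩, 𝒜.restr_of_le hle hbY]
        rcases hle.eq_or_lt with heq | hlt
        · rw [s.eq_single_last, ← heq, 𝒜.restr_of_le le_rfl hbY]
        · have h1 := congrFun h0 (s.snoc Y hlt)
          simp only [sheafD, Chain.erase_castSucc_snoc_one, Chain.erase_last_snoc,
            Chain.last_snoc] at h1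
          simpa [← sub_eq_add_neg, sub_eq_zero] using h1
      · rw [if_pos hY, if_neg (fun h => hle h.2), 𝒜.restr_of_not_le hle hbY]
    · rw [if_neg hY, if_neg (fun h => hY h.1), map_zero]

open Classical in
-- The contracting homotopy: e(s) is, up to sign, the sum of b(s > Y) over the flats Y of
-- codimension p below the end of s. The equation d e = b is checked on each Brieskorn component.
theorem exists_sheafD_eq [FiniteDimensional ℂ V] {b : 𝒜.Chain (q + 2) → 𝒜.OS}
    (hb : b ∈ 𝒜.sheafCochains p (q + 1)) (h0 : 𝒜.sheafD (q + 1) b = 0) :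
    ∃ e ∈ 𝒜.sheafCochains p q, 𝒜.sheafD q e = b := by
  rw [mem_sheafCochains] at hb
  let B (s : 𝒜.Chain (q + 1)) (Y : 𝒜.IntPoset) : 𝒜.OS :=
    if h : Y < s.last then b (s.snoc Y h) else 0
  have hBpos : ∀ s Y (h : Y < s.last), B s Y = b (s.snoc Y h) := fun s Y h => dif_pos h
  have hBneg : ∀ s Y, ¬ Y < s.last → B s Y = 0 := fun s Y h => dif_neg h
  have hB : ∀ s Y, B s Y ∈ 𝒜.stalk p Y := by
    intro s Y
    by_cases h : Y < s.last
    · have := hb (s.snoc Y h)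
      rwa [Chain.last_snoc, ← hBpos] at this
    · rw [hBneg s Y h]
      exact zero_mem _
  refine ⟨fun s => ∑ Y with Y.codim = p, (-1 : ℂ) ^ (q + 1) • B s Y,
    mem_sheafCochains.2 fun s => sum_mem fun Y _ => Submodule.smul_mem _ _ ?_,
    funext fun s => ?_⟩
  · by_cases h : Y < s.last
    · exact 𝒜.stalk_mono p h.le (hB s Y)
    · rw [hBneg s Y h]
      exact zero_mem _
  have key : ∀ Y : 𝒜.IntPoset, Y.codim = p →
      (∑ j : Fin (q + 1), (-1 : ℂ) ^ (j : ℕ) • (-1 : ℂ) ^ (q + 1) • B (s.erase j.castSucc) Y) +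
        (-1 : ℂ) ^ (q + 1) • 𝒜.restr s.last
          ((-1 : ℂ) ^ (q + 1) • B (s.erase (Fin.last (q + 1))) Y) =
      if Y ≤ s.last then 𝒜.restr Y (b s) else 0 := by
    intro Y hY
    subst hY
    have hsq : (-1 : ℂ) ^ (q + 1) * (-1 : ℂ) ^ (q + 1) = 1 := by
      rw [← mul_pow]
      simp
    rw [map_smul, smul_smul, hsq, one_smul]
    have hz : ¬ Y < s.last → ∑ j : Fin (q + 1), (-1 : ℂ) ^ (j : ℕ) • (-1 : ℂ) ^ (q + 1) •
        B (s.erase j.castSucc) Y = 0 := by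
      intro h
      refine Finset.sum_eq_zero fun j _ => ?_
      rw [hBneg _ _ (by rwa [s.last_erase_castSucc]), smul_zero, smul_zero]
    by_cases hle : Y ≤ s.last
    · rw [if_pos hle]
      -- If Y is the last element of s, only the last face can be extended by Y, and that extension
      -- is s itself. If Y is strictly below, the claim is the cocycle condition on s > Y.
      rcases hle.eq_or_lt with heq | hlt
      · rw [hz heq.not_lt, zero_add]
        subst heq
        rw [hBpos _ _ s.last_lt_last_erase_last, s.snoc_erase_last]
      · have h1 := congrFun h0 (s.snoc Y hlt)
        simp only [sheafD, Chain.erase_castSucc_snoc, Chain.erase_last_snoc, Chain.last_snoc,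
          Pi.zero_apply] at h1
        simp only [← hBpos] at h1
        rw [Fin.sum_univ_castSucc] at h1
        rw [𝒜.restr_of_le hle (hB _ Y)]
        simp only [smul_comm _ ((-1 : ℂ) ^ (q + 1)), ← Finset.smul_sum]
        have h2 := congrArg (fun a => (-1 : ℂ) ^ (q + 1) • a) h1
        simp only [smul_add, smul_smul, smul_zero, Fin.val_last, hsq, one_smul, Fin.val_castSucc,
          pow_succ _ (q + 1)] at h2
        rw [← mul_assoc, hsq, one_mul, neg_one_smul, ← sub_eq_add_neg, sub_eq_zero] at h2
        exact h2
    · rw [if_neg hle, hz (fun h => hle h.le), 𝒜.restr_of_not_le hle (hB _ Y), add_zero]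
  rw [𝒜.eq_sum_restr_of_mem_stalk (hb s)]
  simp only [sheafD, map_sum, Finset.smul_sum]
  rw [Finset.sum_comm, ← Finset.sum_add_distrib]
  simp only [ite_and]
  rw [← Finset.sum_filter]
  exact Finset.sum_congr rfl fun Y hY => key Y (Finset.mem_filter.1 hY).2

end Double

end HypArrangement

end

/-! ### Zigzags, their cohomology classes, and the zigzags of flag forms. -/

noncomputable section

namespace HypArrangement

variable {ι V : Type*} [AddCommGroup V] [Module ℂ V] {𝒜 : HypArrangement ι V}

theorem gam_zero {q : ℕ} : 𝒜.gam q 0 = 0 := by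
  simpa using gam_sub (𝒜 := 𝒜) (q := q) 0 0

/-- The first `q + 1` elements of the simplex `ξ` are those of the chain `s`. -/
def Simplex.Extends {r q : ℕ} (ξ : 𝒜.Simplex r) (s : 𝒜.Chain (q + 1)) : Prop :=
  ∀ (i : Fin (q + 1)) (h : (i : ℕ) < r), ξ.1.1 ⟨i, h⟩ = s.1 i

theorem Simplex.extends_iff {r q : ℕ} (ξ : 𝒜.Simplex r) (hq : q + 1 < r) (s : 𝒜.Chain (q + 2)) :
    ξ.Extends s ↔ ξ.Extends (s.erase (Fin.last (q + 1))) ∧ ξ.1.1 ⟨q + 1, hq⟩ = s.last := by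
  have he : ∀ i : Fin (q + 1), (s.erase (Fin.last (q + 1))).1 i = s.1 i.castSucc := by
    intro i
    change s.1 ((Fin.last (q + 1)).succAbove i) = _
    rw [Fin.succAbove_last]
  constructor
  · intro h
    exact ⟨fun i hi => (h i.castSucc hi).trans (he i).symm, h (Fin.last (q + 1)) hq⟩
  · rintro ⟨h1, h2⟩ i hi
    induction i using Fin.lastCases with
    | last => exact h2
    | cast i => exact (h1 i hi).trans (he i)

variable [Fintype ι] {lam : ι → ℂ}

/-! ### Linearity of zigzags -/

theorem globalSection_sub (a b : 𝒜.OS) :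
    𝒜.globalSection (a - b) = 𝒜.globalSection a - 𝒜.globalSection b :=
  funext fun _ => map_sub _ _ _

theorem sheafD_smul {q : ℕ} (t : ℂ) (b : 𝒜.Chain (q + 1) → 𝒜.OS) :
    𝒜.sheafD q (t • b) = t • 𝒜.sheafD q b := by
  funext s
  simp only [sheafD, Pi.smul_apply, map_smul, smul_add, Finset.smul_sum, smul_comm t]

theorem dLam_smul {q : ℕ} (t : ℂ) (b : 𝒜.Chain (q + 1) → 𝒜.OS) :
    𝒜.dLam lam (t • b) = t • 𝒜.dLam lam b := by
  funext s
  simp only [dLam, Pi.smul_apply, mul_smul_comm]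

theorem IsZigzag.sub {r : ℕ} {a a' : 𝒜.OS} {f f' : 𝒜.FCochain r} (h : 𝒜.IsZigzag lam r a f)
    (h' : 𝒜.IsZigzag lam r a' f') : 𝒜.IsZigzag lam r (a - a') (f - f') := by
  obtain ⟨b, c, h1, h2, h3⟩ := h
  obtain ⟨b', c', h1', h2', h3'⟩ := h'
  refine ⟨fun q => b q - b' q, fun q => c q - c' q, ?_, fun q hq => ⟨?_, ?_, ?_⟩, ?_⟩
  · change c 0 - c' 0 = _
    rw [h1, h1', globalSection_sub]
  · exact sub_mem (h2 q hq).1 (h2' q hq).1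
  · rw [dLam_sub, (h2 q hq).2.1, (h2' q hq).2.1]
  · change c (q + 1) - c' (q + 1) = _
    rw [sheafD_sub, (h2 q hq).2.2, (h2' q hq).2.2]
  · change c r - c' r = _
    rw [h3, h3', gam_sub]

/-! ### Zigzags and cohomology classes -/

theorem globalSection_zero : 𝒜.globalSection 0 = 0 :=
  funext fun _ => map_zero _

/-- A primitive of a is carried down the staircase: each c_{q+1} is d of a d_λ-closed β_q. Exactness
of d_λ gives β_q = d_λ e, and b_{q+1} - d e is the next β. The last one lies in F^0, so it is γ of a
primitive of f. -/
theorem IsZigzag.mem_fCoboundaries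
    (hlam : ∀ X : 𝒜.IntPoset, 𝒜.IsDense X → ∑ i ∈ 𝒜.loc X, lam i ≠ 0) {r : ℕ} {a : 𝒜.OS}
    {f : 𝒜.FCochain r} (h : 𝒜.IsZigzag lam r a f) (ha : a ∈ 𝒜.osCoboundaries lam r) :
    f ∈ 𝒜.fCoboundaries r := by
  obtain ⟨b, c, h1, h2, h3⟩ := h
  cases r with
  | zero =>
    have ha' : a = 0 := ha
    rw [h1, ha', globalSection_zero, ← gam_zero] at h3
    exact gam_injective h3.symm
  | succ r =>
    obtain ⟨a', ha', rfl⟩ := ha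
    rw [LinearMap.mulLeft_apply, ← dLam_globalSection] at h1
    have key : ∀ q ≤ r, ∃ β ∈ 𝒜.sheafCochains (r - q) q,
        𝒜.dLam lam β = 0 ∧ 𝒜.sheafD q β = c (q + 1) := by
      intro q
      induction q with
      | zero =>
        intro hq
        obtain ⟨k1, k2, k3⟩ := h2 0 (Nat.succ_pos r)
        exact ⟨b 0 - 𝒜.globalSection a', sub_mem k1 (globalSection_mem ha'),
          by rw [dLam_sub, k2, h1, sub_self], by rw [sheafD_sub, k3, sheafD_globalSection, sub_zero]⟩
      | succ q ih =>
        intro hq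
        obtain ⟨β, m1, m2, m3⟩ := ih (by omega)
        obtain ⟨k1, k2, k3⟩ := h2 (q + 1) (by omega)
        rw [show r + 1 - 1 - (q + 1) = r - (q + 1) by omega] at k1
        rw [show r - q = r - (q + 1) + 1 by omega] at m1
        obtain ⟨e, he, he'⟩ := exists_dLam_eq hlam m1 m2
        refine ⟨b (q + 1) - 𝒜.sheafD q e, sub_mem k1 (sheafD_mem he), ?_, ?_⟩
        · rw [dLam_sub, k2, ← sheafD_dLam, he', m3, sub_self]
        · rw [sheafD_sub, ← k3, sheafD_sheafD he, sub_zero]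
    obtain ⟨β, m1, m2, m3⟩ := key r le_rfl
    rw [Nat.sub_self] at m1
    obtain ⟨g, rfl⟩ := exists_gam_eq hlam m1 m2
    rw [h3, sheafD_gam] at m3
    exact ⟨g, gam_injective m3⟩

/-- The same argument from the other end, with the exactness of d in place of that of d_λ; the
induction is on r - q since q descends. -/
theorem IsZigzag.mem_osCoboundaries [FiniteDimensional ℂ V] {r : ℕ} {a : 𝒜.OS}
    {f : 𝒜.FCochain r} (h : 𝒜.IsZigzag lam r a f) (ha : a ∈ 𝒜.grade r)
    (hf : f ∈ 𝒜.fCoboundaries r) : a ∈ 𝒜.osCoboundaries lam r := by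
  obtain ⟨b, c, h1, h2, h3⟩ := h
  cases r with
  | zero =>
    have hf' : f = 0 := hf
    rw [h1, hf', gam_zero, ← globalSection_zero] at h3
    exact globalSection_injOn ha (zero_mem _) h3
  | succ r =>
    obtain ⟨g, rfl⟩ := hf
    rw [← sheafD_gam] at h3
    have key : ∀ k q, q + k = r → ∃ β ∈ 𝒜.sheafCochains (r - q) q,
        𝒜.sheafD q β = 0 ∧ 𝒜.dLam lam β = c q := by
      intro k
      induction k with
      | zero =>
        rintro q rfl
        obtain ⟨k1, k2, k3⟩ := h2 q (Nat.lt_succ_self q)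
        refine ⟨b q - 𝒜.gam q g, sub_mem k1 ?_, ?_, ?_⟩
        · simpa using gam_mem g
        · rw [sheafD_sub, ← k3, sub_eq_zero]
          exact h3
        · rw [dLam_sub, k2, dLam_gam, sub_zero]
      | succ k ih =>
        intro q hq
        obtain ⟨β, m1, m2, m3⟩ := ih (q + 1) (by omega)
        obtain ⟨k1, k2, k3⟩ := h2 q (by omega)
        obtain ⟨e, he, rfl⟩ := exists_sheafD_eq m1 m2
        refine ⟨b q - 𝒜.dLam lam e, sub_mem k1 ?_, ?_, ?_⟩
        · have h4 := dLam_mem (lam := lam) he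
          rwa [show r - (q + 1) + 1 = r - q by omega] at h4
        · rw [sheafD_sub, ← k3, sheafD_dLam, m3, sub_self]
        · rw [dLam_sub, k2, dLam_dLam, sub_zero]
    obtain ⟨β, m1, m2, m3⟩ := key r 0 (zero_add r)
    obtain ⟨a', ha', rfl⟩ := exists_globalSection_eq m1 m2
    rw [h1, dLam_globalSection] at m3
    exact ⟨a', ha', globalSection_injOn (𝒜.ωTotal_mul_mem_grade lam ha') ha m3⟩

theorem exists_isZigzag
    (hlam : ∀ X : 𝒜.IntPoset, 𝒜.IsDense X → ∑ i ∈ 𝒜.loc X, lam i ≠ 0) {r : ℕ} {a : 𝒜.OS}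
    (ha : a ∈ 𝒜.osCocycles lam r) : ∃ f, 𝒜.IsZigzag lam r a f := by
  classical
  obtain ⟨ha, ha0⟩ := ha
  have ha0' : 𝒜.ωTotal lam * a = 0 := ha0
  -- The default 0 plays no role: for q < r the lift exists, because c_q is closed under both
  -- differentials.
  let step (q : ℕ) (c : 𝒜.Chain (q + 1) → 𝒜.OS) : 𝒜.Chain (q + 1) → 𝒜.OS :=
    if h : ∃ e ∈ 𝒜.sheafCochains (r - 1 - q) q, 𝒜.dLam lam e = c then h.choose else 0
  let c : (q : ℕ) → 𝒜.Chain (q + 1) → 𝒜.OS :=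
    Nat.rec (𝒜.globalSection a) fun q c => 𝒜.sheafD q (step q c)
  have hstep : ∀ q < r, c q ∈ 𝒜.sheafCochains (r - q) q → 𝒜.dLam lam (c q) = 0 →
      step q (c q) ∈ 𝒜.sheafCochains (r - 1 - q) q ∧ 𝒜.dLam lam (step q (c q)) = c q := by
    intro q hq h1 h2
    rw [show r - q = r - 1 - q + 1 by omega] at h1
    have h := exists_dLam_eq hlam h1 h2
    simp only [step, dif_pos h]
    exact h.choose_spec
  have hc : ∀ q ≤ r, c q ∈ 𝒜.sheafCochains (r - q) q ∧ 𝒜.dLam lam (c q) = 0 ∧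
      𝒜.sheafD q (c q) = 0 := by
    intro q
    induction q with
    | zero =>
      intro _
      refine ⟨globalSection_mem ha, ?_, sheafD_globalSection a⟩
      rw [show c 0 = 𝒜.globalSection a from rfl, dLam_globalSection, ha0', globalSection_zero]
    | succ q ih =>
      intro hq
      obtain ⟨h1, h2, h3⟩ := ih (by omega)
      obtain ⟨h4, h5⟩ := hstep q (by omega) h1 h2
      have h6 : c (q + 1) = 𝒜.sheafD q (step q (c q)) := rfl
      rw [h6]
      refine ⟨?_, ?_, sheafD_sheafD h4⟩
      · rw [show r - (q + 1) = r - 1 - q by omega]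
        exact sheafD_mem h4
      · rw [← sheafD_dLam, h5, h3]
  obtain ⟨h1, h2, -⟩ := hc r le_rfl
  rw [Nat.sub_self] at h1
  obtain ⟨f, hf⟩ := exists_gam_eq hlam h1 h2
  refine ⟨f, fun q => step q (c q), c, rfl, fun q hq => ?_, hf.symm⟩
  obtain ⟨h1, h2, -⟩ := hc q hq.le
  exact ⟨(hstep q hq h1 h2).1, (hstep q hq h1 h2).2, rfl⟩

/-! ### The zigzag of a flag form -/

/-- `ω_λ(X_{k+1}) ⋯ ω_λ(X_r)` for a simplex `(X_1 > ⋯ > X_r)`. -/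
def tailProd (lam : ι → ℂ) {r : ℕ} (ξ : 𝒜.Simplex r) (k : ℕ) : 𝒜.OS :=
  ((List.ofFn fun j => 𝒜.ωAt lam (ξ.1.1 j)).drop k).prod

theorem tailProd_eq_mul {r : ℕ} (ξ : 𝒜.Simplex r) {k : ℕ} (hk : k < r) :
    tailProd lam ξ k = 𝒜.ωAt lam (ξ.1.1 ⟨k, hk⟩) * tailProd lam ξ (k + 1) := by
  rw [tailProd, List.drop_eq_getElem_cons (by simpa using hk), List.prod_cons, List.getElem_ofFn]
  rfl

theorem tailProd_self {r : ℕ} (ξ : 𝒜.Simplex r) : tailProd lam ξ r = 1 := by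
  rw [tailProd, List.drop_eq_nil_of_le (by simp), List.prod_nil]

theorem tailProd_mem {r : ℕ} (ξ : 𝒜.Simplex r) {n k : ℕ} (h : k + n = r) {X : 𝒜.IntPoset}
    (hX : ∀ hk : k < r, ξ.1.1 ⟨k, hk⟩ ≤ X) : tailProd lam ξ k ∈ 𝒜.stalk n X := by
  induction n generalizing k X with
  | zero =>
    obtain rfl : k = r := h
    rw [tailProd_self]
    exact mem_stalk_zero.2 ⟨1, map_one _⟩
  | succ n ih =>
    have hk : k < r := by omega
    rw [tailProd_eq_mul ξ hk]
    refine 𝒜.stalk_mono _ (hX hk) (𝒜.ωAt_mul_mem_stalk lam (ih (by omega) fun hk' => ?_))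
    exact (ξ.1.2 (Fin.mk_lt_mk.2 (Nat.lt_succ_self k))).le

open Classical in
-- The degree r - k of the tail is the codimension of its first flat, so the tail lies in the
-- Brieskorn summand of that flat. A flat X of no larger codimension can lie above it only by being
-- equal to it.
theorem restr_tailProd [FiniteDimensional ℂ V] {r : ℕ} (hr : 𝒜.rank = r) (ξ : 𝒜.Simplex r)
    {k : ℕ} (hk : k < r) {X : 𝒜.IntPoset} (hX : X.codim + k ≤ r) :
    𝒜.restr X (tailProd lam ξ k) = if ξ.1.1 ⟨k, hk⟩ = X then tailProd lam ξ k else 0 := by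
  subst hr
  have h1 : (ξ.1.1 ⟨k, hk⟩).codim + k = 𝒜.rank := ξ.codim_eq ⟨k, hk⟩
  have h2 : tailProd lam ξ k ∈ 𝒜.stalk (ξ.1.1 ⟨k, hk⟩).codim (ξ.1.1 ⟨k, hk⟩) :=
    tailProd_mem ξ (by omega) fun _ => le_rfl
  split_ifs with h
  · exact 𝒜.restr_of_le h.le h2
  · exact 𝒜.restr_of_not_le (fun hle => h (eq_of_le_of_codim_le hle (by omega))) h2

theorem upsilon_eq {r : ℕ} (f : 𝒜.FCochain r) :
    𝒜.upsilon lam r f = ∑ ξ : 𝒜.Simplex r, f ξ • tailProd lam ξ 0 := rfl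

theorem upsilon_mem_grade {r : ℕ} (f : 𝒜.FCochain r) : 𝒜.upsilon lam r f ∈ 𝒜.grade r := by
  rw [upsilon_eq]
  refine sum_mem fun ξ _ => Submodule.smul_mem _ _ ?_
  cases r with
  | zero =>
    rw [tailProd_self, grade, pow_zero]
    exact Submodule.mem_one.2 ⟨1, map_one _⟩
  | succ r => 
    exact 𝒜.stalk_le_grade _ _
      (tailProd_mem ξ (X := ξ.1.1 ⟨0, Nat.succ_pos r⟩) (zero_add _) fun _ => le_rfl)

open Classical in
/-- The cochain `(X_0 > ⋯ > X_q) ↦ ∑ f(X_0, …, X_q, Y_{q+1}, …) ω_λ(Y_{q+1}) ⋯ ω_λ(Y_{r-1})`. -/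
def flagCochain (lam : ι → ℂ) {r : ℕ} (f : 𝒜.FCochain r) (q : ℕ) : 𝒜.Chain (q + 1) → 𝒜.OS :=
  fun s => ∑ ξ : 𝒜.Simplex r with ξ.Extends s, f ξ • tailProd lam ξ (q + 1)

theorem flagCochain_mem {r : ℕ} (f : 𝒜.FCochain r) {q : ℕ} (hq : q < r) :
    flagCochain lam f q ∈ 𝒜.sheafCochains (r - 1 - q) q := by
  classical
  refine mem_sheafCochains.2 fun s => sum_mem fun ξ hξ => Submodule.smul_mem _ _
    (tailProd_mem ξ (by omega) fun hk => ?_)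
  rw [Chain.last, ← (Finset.mem_filter.1 hξ).2 (Fin.last q) hq]
  exact (ξ.1.2 (Fin.mk_lt_mk.2 (by simp))).le

theorem dLam_flagCochain {r : ℕ} (f : 𝒜.FCochain r) {q : ℕ} (hq : q < r)
    (s : 𝒜.Chain (q + 1)) [DecidablePred fun ξ : 𝒜.Simplex r => ξ.Extends s] :
    𝒜.dLam lam (flagCochain lam f q) s =
      ∑ ξ : 𝒜.Simplex r with ξ.Extends s, f ξ • tailProd lam ξ q := by
  rw [dLam, flagCochain, Finset.mul_sum]
  refine Finset.sum_congr (by congr!) fun ξ hξ => ?_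
  rw [mul_smul_comm, tailProd_eq_mul ξ hq, Chain.last,
    ← (Finset.mem_filter.1 hξ).2 (Fin.last q) hq]
  rfl

theorem globalSection_upsilon [FiniteDimensional ℂ V] {r : ℕ} (hr : 𝒜.rank = r) (h0 : 0 < r)
    (f : 𝒜.FCochain r) :
    𝒜.globalSection (𝒜.upsilon lam r f) = 𝒜.dLam lam (flagCochain lam f 0) := by
  classical
  funext s
  rw [dLam_flagCochain f h0, globalSection, upsilon_eq, map_sum, Finset.sum_filter]
  refine Finset.sum_congr rfl fun ξ _ => ?_
  rw [map_smul, restr_tailProd hr ξ h0 (by rw [← hr]; exact codim_le_rank _), smul_ite, smul_zero]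
  refine if_congr ⟨fun h i hi => ?_, fun h => h 0 h0⟩ rfl rfl
  obtain rfl : i = 0 := Fin.fin_one_eq_zero i
  exact h

/-- Erasing an element before the last puts the end of s in position q, where its codimension is at
most r - q - 1. A full flag has codimension r - q there, so no flag extends the face. -/
theorem flagCochain_erase_castSucc [FiniteDimensional ℂ V] {r : ℕ} (hr : 𝒜.rank = r)
    (f : 𝒜.FCochain r) {q : ℕ} (hq : q < r) (s : 𝒜.Chain (q + 2)) (j : Fin (q + 1)) :
    flagCochain lam f q (s.erase j.castSucc) = 0 := by
  classical
  subst hr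
  rw [flagCochain, Finset.filter_false_of_mem, Finset.sum_empty]
  intro ξ _ hξ
  have h1 : ξ.1.1 ⟨q, hq⟩ = (s.erase j.castSucc).last := hξ (Fin.last q) hq
  have h2 := ξ.codim_eq ⟨q, hq⟩
  have h3 := s.codim_le (Fin.last (q + 1))
  rw [h1, s.last_erase_castSucc] at h2
  rw [Fin.val_last] at h3
  simp only [Chain.last] at h2
  omega

theorem sheafD_flagCochain_apply [FiniteDimensional ℂ V] {r : ℕ} (hr : 𝒜.rank = r)
    (f : 𝒜.FCochain r) {q : ℕ} (hq : q < r) (s : 𝒜.Chain (q + 2)) :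
    𝒜.sheafD q (flagCochain lam f q) s = (-1 : ℂ) ^ (q + 1) •
      𝒜.restr s.last (flagCochain lam f q (s.erase (Fin.last (q + 1)))) := by
  rw [sheafD, Finset.sum_eq_zero fun j _ => ?_, zero_add]
  rw [flagCochain_erase_castSucc hr f hq, smul_zero]

/-- Only the last face remains, and restricting to the last element of s keeps precisely the flags
whose next vertex is that element. -/
theorem sheafD_flagCochain [FiniteDimensional ℂ V] {r : ℕ} (hr : 𝒜.rank = r)
    (f : 𝒜.FCochain r) {q : ℕ} (hq : q + 1 < r) :
    𝒜.sheafD q (flagCochain lam f q) =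
      (-1 : ℂ) ^ (q + 1) • 𝒜.dLam lam (flagCochain lam f (q + 1)) := by
  classical
  funext s
  rw [sheafD_flagCochain_apply hr f (by omega), Pi.smul_apply, dLam_flagCochain f hq, flagCochain,
    map_sum]
  congr 1
  have hc : s.last.codim + (q + 1) ≤ r := hr ▸ s.codim_le (Fin.last (q + 1))
  simp only [map_smul, restr_tailProd hr _ hq hc, smul_ite, smul_zero]
  rw [← Finset.sum_filter, Finset.filter_filter]
  refine Finset.sum_congr ?_ fun _ _ => rfl
  ext ξ
  simp only [Finset.mem_filter, Finset.mem_univ, true_and]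
  exact (ξ.extends_iff hq s).symm

theorem sheafD_flagCochain_last [FiniteDimensional ℂ V] {q : ℕ} (hr : 𝒜.rank = q + 1)
    (f : 𝒜.FCochain (q + 1)) :
    𝒜.sheafD q (flagCochain lam f q) = (-1 : ℂ) ^ (q + 1) • 𝒜.gam (q + 1) f := by
  classical
  funext s
  have hs : s.last = 𝒜.whole := by
    refine eq_whole_of_codim_eq_zero ?_
    have h : s.last.codim + (q + 1) ≤ 𝒜.rank := s.codim_le (Fin.last (q + 1))
    omega
  rw [sheafD_flagCochain_apply hr f (Nat.lt_succ_self q), Pi.smul_apply, flagCochain, map_sum, gam,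
    if_pos hs]
  congr 1
  simp only [tailProd_self, ← Algebra.algebraMap_eq_smul_one, AlgHom.commutes]
  let ξ₀ : 𝒜.Simplex (q + 1) := ⟨s.erase (Fin.last (q + 1)), erase_last_ne_whole s⟩
  have hξ₀ : ξ₀.Extends (s.erase (Fin.last (q + 1))) := fun _ _ => rfl
  refine Finset.sum_eq_single_of_mem ξ₀ (Finset.mem_filter.2 ⟨Finset.mem_univ _, hξ₀⟩) ?_
  intro ξ hξ hne
  exact absurd (Subtype.ext (Chain.ext fun k => (Finset.mem_filter.1 hξ).2 k k.2)) hne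

theorem isZigzag_upsilon [FiniteDimensional ℂ V] {r : ℕ} (hr : 𝒜.rank = r) (f : 𝒜.FCochain r) :
    𝒜.IsZigzag lam r ((-1 : ℂ) ^ (r * (r + 1) / 2) • 𝒜.upsilon lam r f) f := by
  -- Step q of the zigzag multiplies by (-1)^(q+1); triangular exponents absorb this, and the
  -- constant summand normalises `ε r` to 1. The sign in front of υ is `ε 0`.
  let ε (q : ℕ) : ℂ := (-1) ^ (r * (r + 1) / 2 + q * (q + 1) / 2)
  have hε : ∀ q, ε q * (-1) ^ (q + 1) = ε (q + 1) := by
    intro q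
    have h : (q + 1) * (q + 1 + 1) / 2 = q * (q + 1) / 2 + (q + 1) := by
      rw [show (q + 1) * (q + 1 + 1) = q * (q + 1) + (q + 1) * 2 by ring,
        Nat.add_mul_div_right _ _ two_pos]
    simp only [ε]
    rw [h, ← pow_add, add_assoc]
  have hεr : ε r = 1 := by
    simp only [ε]
    rw [← two_mul, pow_mul]
    simp
  have hg : ∀ (t : ℂ) (a : 𝒜.OS), 𝒜.globalSection (t • a) = t • 𝒜.globalSection a :=
    fun t a => funext fun _ => map_smul _ _ _
  refine ⟨fun q => ε q • flagCochain lam f q, fun q => q.casesOn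
    (𝒜.globalSection ((-1 : ℂ) ^ (r * (r + 1) / 2) • 𝒜.upsilon lam r f))
    fun q => 𝒜.sheafD q (ε q • flagCochain lam f q), rfl, fun q hq =>
    ⟨Submodule.smul_mem _ _ (flagCochain_mem f hq), ?_, rfl⟩, ?_⟩
  · rw [dLam_smul]
    cases q with
    | zero =>
      simp only [hg, globalSection_upsilon hr hq]
      rfl
    | succ q => simp only [sheafD_smul, sheafD_flagCochain hr f hq, smul_smul, hε]
  · cases r with
    -- In rank zero there are no steps: the only flag is empty, and the global section of the scalar
    -- f is already γ f.
    | zero =>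
      funext s
      have hs : s.last = 𝒜.whole := by
        refine eq_whole_of_codim_eq_zero ?_
        have h := codim_le_rank s.last
        omega
      rw [gam, if_pos hs]
      change 𝒜.globalSection _ s = _
      simp only [zero_mul, Nat.zero_div, pow_zero, one_smul, globalSection, upsilon_eq,
        tailProd_self, map_sum, map_smul, map_one]
      rw [Finset.sum_eq_single_of_mem ⟨s.erase (Fin.last 0), erase_last_ne_whole s⟩
        (Finset.mem_univ _), Algebra.algebraMap_eq_smul_one]
      intro ξ _ hne
      exact absurd (Subtype.ext (Chain.ext fun k => k.elim0)) hne
    | succ q => simp only [sheafD_smul, sheafD_flagCochain_last hr, smul_smul, hε, hεr, one_smul]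

theorem fCoboundary_rank_eq_zero [FiniteDimensional ℂ V] (f : 𝒜.FCochain 𝒜.rank) :
    𝒜.fCoboundary 𝒜.rank f = 0 := by
  have := 𝒜.isEmpty_simplex_rank_add_one
  exact Subsingleton.elim _ _

theorem smul_upsilon_mem_osCocycles [FiniteDimensional ℂ V] (t : ℂ) (f : 𝒜.FCochain 𝒜.rank) :
    t • 𝒜.upsilon lam 𝒜.rank f ∈ 𝒜.osCocycles lam 𝒜.rank := by
  have h := Submodule.smul_mem _ t (upsilon_mem_grade (lam := lam) f)
  exact ⟨h, 𝒜.eq_zero_of_mem_grade_of_rank_lt (𝒜.ωTotal_mul_mem_grade lam h)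
    (Nat.lt_succ_self _)⟩

end HypArrangement

end

/-! ### The isomorphism. -/

open HypArrangement in
theorem proposition3p3 {ι V : Type*} [Fintype ι] [AddCommGroup V] [Module ℂ V]
    [FiniteDimensional ℂ V] (𝒜 : HypArrangement ι V) (lam : ι → ℂ)
    (hlam : ∀ X : 𝒜.IntPoset, 𝒜.IsDense X → ∑ i ∈ 𝒜.loc X, lam i ≠ 0) :
    ∃ φ : 𝒜.OSCohomology lam 𝒜.rank ≃ₗ[ℂ] 𝒜.FCohomology 𝒜.rank,
      𝒜.IsYuzvinskyMap lam 𝒜.rank φ ∧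
      ∀ z : LinearMap.ker (𝒜.fCoboundary 𝒜.rank),
        ∃ h : (-1 : ℂ) ^ (𝒜.rank * (𝒜.rank + 1) / 2) • 𝒜.upsilon lam 𝒜.rank z.1 ∈
            𝒜.osCocycles lam 𝒜.rank,
          φ.symm (Submodule.Quotient.mk z) = Submodule.Quotient.mk ⟨_, h⟩ := by
  let Υ : LinearMap.ker (𝒜.fCoboundary 𝒜.rank) →ₗ[ℂ] 𝒜.osCocycles lam 𝒜.rank :=
    (((-1 : ℂ) ^ (𝒜.rank * (𝒜.rank + 1) / 2) • 𝒜.upsilon lam 𝒜.rank) ∘ₗ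
      (LinearMap.ker (𝒜.fCoboundary 𝒜.rank)).subtype).codRestrict _
      fun z => smul_upsilon_mem_osCocycles _ z.1
  have hΥ : ∀ z, 𝒜.IsZigzag lam 𝒜.rank (Υ z).1 z.1 := fun z => isZigzag_upsilon rfl z.1
  -- Two zigzags with the same end differ by a zigzag ending in 0, so their starting points are
  -- cohomologous.
  have hmem : ∀ (a : 𝒜.osCocycles lam 𝒜.rank) (z : LinearMap.ker (𝒜.fCoboundary 𝒜.rank)),
      𝒜.IsZigzag lam 𝒜.rank a.1 z.1 → a.1 - (Υ z).1 ∈ 𝒜.osCoboundaries lam 𝒜.rank := by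
    intro a z h
    have h1 := h.sub (hΥ z)
    rw [sub_self] at h1
    exact h1.mem_osCoboundaries (sub_mem a.2.1 (Υ z).2.1) (zero_mem _)
  let ψ : 𝒜.FCohomology 𝒜.rank →ₗ[ℂ] 𝒜.OSCohomology lam 𝒜.rank :=
    Submodule.mapQ _ _ Υ fun z hz => (hΥ z).mem_osCoboundaries (Υ z).2.1 hz
  have hψ : ∀ z, ψ (Submodule.Quotient.mk z) = Submodule.Quotient.mk (Υ z) := fun z => rfl
  have heq : ∀ (a : 𝒜.osCocycles lam 𝒜.rank) (z : LinearMap.ker (𝒜.fCoboundary 𝒜.rank)),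
      𝒜.IsZigzag lam 𝒜.rank a.1 z.1 →
        ψ (Submodule.Quotient.mk z) = Submodule.Quotient.mk a := by
    intro a z h
    rw [hψ, eq_comm, Submodule.Quotient.eq]
    exact hmem a z h
  have hinj : Function.Injective ψ := by
    rw [injective_iff_map_eq_zero]
    intro y hy
    obtain ⟨z, rfl⟩ := Submodule.Quotient.mk_surjective _ y
    rw [hψ, Submodule.Quotient.mk_eq_zero] at hy
    rw [Submodule.Quotient.mk_eq_zero]
    exact (hΥ z).mem_fCoboundaries hlam hy
  have hsurj : Function.Surjective ψ := by
    intro x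
    obtain ⟨a, rfl⟩ := Submodule.Quotient.mk_surjective _ x
    obtain ⟨f, hf⟩ := exists_isZigzag hlam a.2
    exact ⟨Submodule.Quotient.mk ⟨f, fCoboundary_rank_eq_zero f⟩, heq a ⟨f, _⟩ hf⟩
  -- With φ as the inverse of ψ the formula for `φ.symm` holds by definition, and φ x = y becomes x
  -- = ψ y, which is tested on representatives.
  refine ⟨(LinearEquiv.ofBijective ψ ⟨hinj, hsurj⟩).symm, fun x y => ?_, fun z =>
    ⟨smul_upsilon_mem_osCocycles _ z.1, rfl⟩⟩
  refine (LinearEquiv.symm_apply_eq (LinearEquiv.ofBijective ψ ⟨hinj, hsurj⟩)).trans ?_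
  constructor
  · rintro rfl
    obtain ⟨z, rfl⟩ := Submodule.Quotient.mk_surjective _ y
    exact ⟨Υ z, z, rfl, rfl, hΥ z⟩
  · rintro ⟨a, z, rfl, rfl, h⟩
    exact (heq a z h).symm
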